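/- Fix a real constant $\sigma$. For $\nu>0$ and $x>0$ let $$I_s^\nu f(x)=\frac1{\Gamma(\nu)}\int_0^x (x-\tau)^{\nu-1}e^{-\sigma(x-\tau)}f(\tau)\,d\tau ,$$ the integral being understood as a Hadamard finite part if $f$ has a non-integrable power singularity at $0$; let $I_s^0f=f$; and for $\alpha<0$ let $$I_s^{\alpha}f=D_s^{-\alpha}f=\Big(\frac{d}{dx}+\sigma\Big)^{m}\big[I_s^{m+\alpha}f\big],$$ where $m$ is the smallest integer exceeding $-\alpha$. Given a sequence $(\omega_j)_{j\ge0}$ of complex numbers and a step size $h>0$, put $\kappa_j=e^{-j\sigma h}\omega_j$ and, at $x=nh$, $$E_{s,h}^\alpha f(x)=h^\alpha\sum_{j=0}^n\kappa_{n-j}f(jh)-I_s^\alpha f(x).$$ The convolution quadrature $\kappa$ is called convergent of order $p\in\{0,1,2,\dots\}$ (to $I_s^\alpha$) if, as $h=1/n\to0$, $$E_{s,h}^\alpha[e^{-\sigma t}t^{z-1}](1)=O(h^{z})+O(h^p)\quad\text{for all } z\in\mathbb C,\ z\ne0,-1,-2,\dots$$ (in these formulas and below, $0^{0}=1$ and $0^{z}=0$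 for $z\neq0$, i.e. the value at $0$ is discarded where the power function is singular). **Theorem.** Let $\alpha\in\mathbb R$, $p\in\{0,1,2,\dots\}$ and $\beta\in\mathbb C$, where $\beta\ne0,-1,-2,\dots$ if $\alpha\ge0$, and $\Re\beta>\lceil-\alpha\rceil$ if $\alpha<0$. There are integers $N,r\ge0$, depending only on $\alpha,\beta,p$, such that for every real $\sigma$ and every sequence $\omega$ for which $\kappa$ is convergent of order $p$ to $I_s^\alpha$ there exist starting weights $\kappa_{n,j}=\kappa_{n,j}(h)$ ($h>0$, $n\ge1$, $1\le j\le r$) with the following properties. (a) For all $h>0$ and $n\ge1$ they solve the Vandermonde-type system $$\sum_{j=1}^r\kappa_{n,j}e^{-\sigma jh}j^{q+\beta-1}=\frac{\Gamma(q+\beta)}{\Gamma(\alpha+q+\beta)}e^{-\sigma nh}n^{q+\alpha+\beta-1}-\sum_{j=0}^n\kappa_{n-j}e^{-\sigma jh}j^{q+\beta-1},\qquad q=0,1,\dots,r-1,$$ where $1/\Gamma=0$ at the poles of $\Gamma$. (b) For every $f(x)=x^{\beta-1}g(x)$ with $g:[0,\infty)\to\mathbb C$ that is $N$ times continuously differentiable,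 $I_s^\alpha f$ exists on $(0,\infty)$, and the corrected quadrature $$I_{s,h}^\alpha f(x)=h^\alpha\sum_{j=0}^n\kappa_{n-j}f(jh)+h^\alpha\sum_{j=1}^r\kappa_{n,j}f(jh)\qquad(x=nh)$$ satisfies $$I_{s,h}^\alpha f(x)-I_s^\alpha f(x)=O(h^p)\quad\text{uniformly for bounded }x:$$ for every $X>0$ there is a constant $C$ such that the error is at most $Ch^p$ in absolute value for all $h>0$ and $n\ge1$ with $x=nh\le X$. -/

import Mathlib

open Filter Topology MeasureTheory

noncomputable section

namespace SubstantialCalculus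

/-- `L` is the Hadamard finite part of `Φ ε` as `ε → 0+`: up to finitely many terms `c ε ^ l` with
exponents `l ≠ 0`, which are discarded, `Φ ε` tends to `L`. -/
def HasFinitePart (Φ : ℝ → ℂ) (L : ℂ) : Prop :=
  ∃ (s : Finset ℂ) (c : ℂ → ℂ), (0 : ℂ) ∉ s ∧
    Tendsto (fun ε : ℝ => Φ ε - ∑ l ∈ s, c l * (ε : ℂ) ^ l) (𝓝[>] 0) (𝓝 L)

/-- `L` is the finite part of `∫_0^x φ`; the function `φ` may have a non-integrable power
singularity at `0`. If `φ` is integrable on `(0, x)`, this is the ordinary integral, see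
`hasFPIntegral_of_intervalIntegrable`. -/
def HasFPIntegral (φ : ℝ → ℂ) (x : ℝ) (L : ℂ) : Prop :=
  (∀ ε ∈ Set.Ioo 0 x, IntervalIntegrable φ volume ε x) ∧
    HasFinitePart (fun ε : ℝ => ∫ τ in ε..x, φ τ) L

open Classical in
/-- The finite part of `∫_0^x φ` (and `0` if there is none). -/
def fpIntegral (φ : ℝ → ℂ) (x : ℝ) : ℂ :=
  if h : ∃ L, HasFPIntegral φ x L then h.choose else 0

/-- The integrand `(x - τ)^(ν-1) e^(-σ(x-τ)) f(τ)` of the fractional substantial integral. -/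
def substKernel (σ ν : ℝ) (f : ℝ → ℂ) (x : ℝ) : ℝ → ℂ :=
  fun τ => (((x - τ) ^ (ν - 1) * Real.exp (-σ * (x - τ)) : ℝ) : ℂ) * f τ

/-- The fractional substantial integral of order `ν > 0` with lower terminal `0`. -/
def substIntegral (σ ν : ℝ) (f : ℝ → ℂ) (x : ℝ) : ℂ :=
  ((1 / Real.Gamma ν : ℝ) : ℂ) * fpIntegral (substKernel σ ν f x) x

/-- The operator `D_s = d/dx + σ`. -/
def substD (σ : ℝ) (u : ℝ → ℂ) : ℝ → ℂ := fun x => deriv u x + (σ : ℂ) * u x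

/-- The smallest integer that exceeds `μ` (for `μ ≥ 0`). -/
def derivOrder (μ : ℝ) : ℕ := ⌊μ⌋₊ + 1

/-- The fractional substantial derivative of order `μ > 0`: `D_s^m [I_s^(m-μ) f]`, where `m` is the
smallest integer that exceeds `μ`. -/
def substDeriv (σ μ : ℝ) (f : ℝ → ℂ) : ℝ → ℂ :=
  (substD σ)^[derivOrder μ] (substIntegral σ (derivOrder μ - μ) f)

/-- The operator `I_s^α` for real `α`: the substantial integral for `α > 0`, the identity for
`α = 0`, the substantial derivative of order `-α` for `α < 0`. -/
def substOp (σ α : ℝ) (f : ℝ → ℂ) : ℝ → ℂ :=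
  if 0 < α then substIntegral σ α f else if α = 0 then f else substDeriv σ (-α) f

/-- `I_s^α f` exists on `(0, ∞)`: the (finite part) integrals that define it exist and, for `α < 0`,
the function to which `D_s^m` is applied is `m` times continuously differentiable. -/
def SubstOpExists (σ α : ℝ) (f : ℝ → ℂ) : Prop :=
  (0 < α → ∀ x : ℝ, 0 < x → ∃ L, HasFPIntegral (substKernel σ α f x) x L) ∧
  (α < 0 →
    (∀ x : ℝ, 0 < x → ∃ L, HasFPIntegral (substKernel σ (derivOrder (-α) - -α) f x) x L) ∧
    ContDiffOn ℝ (derivOrder (-α)) (substIntegral σ (derivOrder (-α) - -α) f) (Set.Ioi 0))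

/-- The convolution quadrature weights `κ_j = e^(-jσh) ω_j`. -/
def convWeight (σ : ℝ) (ω : ℕ → ℂ) (h : ℝ) (j : ℕ) : ℂ :=
  (Real.exp (-(j * σ * h)) : ℂ) * ω j

/-- The convolution quadrature `h^α ∑_{j=0}^n κ_{n-j} f(jh)` at `x = nh`. -/
def convQuad (σ α : ℝ) (ω : ℕ → ℂ) (h : ℝ) (n : ℕ) (f : ℝ → ℂ) : ℂ :=
  ((h ^ α : ℝ) : ℂ) * ∑ j ∈ Finset.range (n + 1), convWeight σ ω h (n - j) * f (j * h)

/-- The convolution quadrature error `E_{s,h}^α f` at `x = nh`. -/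
def quadError (σ α : ℝ) (ω : ℕ → ℂ) (h : ℝ) (n : ℕ) (f : ℝ → ℂ) : ℂ :=
  convQuad σ α ω h n f - substOp σ α f (n * h)

/-- The convolution quadrature `κ_j = e^(-jσh) ω_j` is convergent of order `p` to `I_s^α`: its error
for `e^(-σt) t^(β-1)` at `x = 1 = nh` is `O(h^β) + O(h^p)`, for every complex `β ≠ 0, -1, -2, …`.
Here `0 ^ 0 = 1`, and `0 ^ z = 0` for all other exponents `z`, so that the value at `t = 0` is
discarded where the power function is singular. -/
def IsConvergentOfOrder (σ α : ℝ) (ω : ℕ → ℂ) (p : ℕ) : Prop :=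
  ∀ β : ℂ, (∀ k : ℕ, β ≠ -(k : ℂ)) →
    (fun n : ℕ => quadError σ α ω (1 / (n : ℝ)) n
        (fun t => (Real.exp (-σ * t) : ℂ) * (t : ℂ) ^ (β - 1)))
      =O[atTop] fun n : ℕ => (1 / (n : ℝ)) ^ β.re + (1 / (n : ℝ)) ^ p

/-- The corrected quadrature `h^α ∑_{j=0}^n κ_{n-j} f(jh) + h^α ∑_{j=1}^r κ_{n,j} f(jh)` at
`x = nh`; `w n j` stands for the starting weight `κ_{n,j}` at step size `h`. -/
def correctedQuad (σ α : ℝ) (ω : ℕ → ℂ) (r : ℕ) (w : ℕ → ℕ → ℂ) (h : ℝ) (n : ℕ)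
    (f : ℝ → ℂ) : ℂ :=
  convQuad σ α ω h n f + ((h ^ α : ℝ) : ℂ) * ∑ j ∈ Finset.Icc 1 r, w n j * f (j * h)

/-- The Vandermonde type system for the starting weights `κ_{n,1}, …, κ_{n,r}`. The quotient
`Γ(q+β)/Γ(α+q+β)` is `0` where the denominator has a pole, in accordance with `1/Γ = 0` there. -/
def StartingSystem (σ α : ℝ) (β : ℂ) (ω : ℕ → ℂ) (r : ℕ) (w : ℕ → ℕ → ℂ) (h : ℝ) (n : ℕ) : Prop :=
  ∀ q < r,
    ∑ j ∈ Finset.Icc 1 r, w n j * (Real.exp (-σ * (j * h)) : ℂ) * (j : ℂ) ^ ((q : ℂ) + β - 1) =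
      Complex.Gamma (q + β) / Complex.Gamma (α + q + β) *
          (Real.exp (-σ * (n * h)) : ℂ) * (n : ℂ) ^ ((q : ℂ) + α + β - 1) -
        ∑ j ∈ Finset.range (n + 1),
          convWeight σ ω h (n - j) * (Real.exp (-σ * (j * h)) : ℂ) * (j : ℂ) ^ ((q : ℂ) + β - 1)

/-- A finite sum of powers with non-zero exponents has no other limit at `0+` than `0`. -/
theorem eq_zero_of_tendsto_sum_cpow (s : Finset ℂ) : ∀ (c : ℂ → ℂ) (L : ℂ), (0 : ℂ) ∉ s →
    Tendsto (fun ε : ℝ => ∑ l ∈ s, c l * (ε : ℂ) ^ l) (𝓝[>] 0) (𝓝 L) → L = 0 := by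
  classical
  induction s using Finset.induction_on with
  | empty =>
    intro c L _ h
    simp only [Finset.sum_empty] at h
    exact tendsto_nhds_unique h tendsto_const_nhds
  | insert μ s hμ ih =>
    intro c L h0 h
    simp only [Finset.mem_insert, not_or] at h0
    obtain ⟨h0, h0s⟩ := h0
    have hμ0 : μ ≠ 0 := fun e => h0 e.symm
    set a : ℝ := Real.exp (-(1 / (‖μ‖ + 1))) with ha
    have hapos : 0 < a := Real.exp_pos _
    have hane : (a : ℂ) ^ μ ≠ 1 := by
      rw [Complex.cpow_def_of_ne_zero (by exact_mod_cast hapos.ne'), ← Complex.ofReal_log hapos.le,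
        ha, Real.log_exp]
      intro e
      obtain ⟨n, hn⟩ := Complex.exp_eq_one_iff.1 e
      have hlt : ‖((-(1 / (‖μ‖ + 1)) : ℝ) : ℂ) * μ‖ < 1 := by
        rw [norm_mul, Complex.norm_real, norm_neg, Real.norm_of_nonneg (by positivity),
          one_div, inv_mul_lt_iff₀ (by positivity)]
        linarith
      rw [hn] at hlt
      have hn0 : n = 0 := by
        by_contra hne
        have h1 : (1 : ℝ) ≤ |(n : ℝ)| := by exact_mod_cast Int.one_le_abs hne
        have h2 : ‖(n : ℂ) * (2 * Real.pi * Complex.I)‖ = |(n : ℝ)| * (2 * Real.pi) := by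
          simp [abs_of_pos Real.pi_pos]
        rw [h2] at hlt
        nlinarith [Real.pi_gt_three]
      rw [hn0] at hn
      have h3 : ((-(1 / (‖μ‖ + 1)) : ℝ) : ℂ) ≠ 0 := by
        have : (0 : ℝ) < 1 / (‖μ‖ + 1) := by positivity
        exact_mod_cast (neg_lt_zero.2 this).ne
      simp only [Int.cast_zero, zero_mul] at hn
      exact (mul_ne_zero h3 hμ0) hn
    have hscale : Tendsto (fun ε : ℝ => a * ε) (𝓝[>] 0) (𝓝[>] 0) := by
      refine tendsto_nhdsWithin_of_tendsto_nhds_of_eventually_within _ ?_ ?_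
      · have : Tendsto (fun ε : ℝ => a * ε) (𝓝 0) (𝓝 (a * 0)) :=
          (continuous_const.mul continuous_id).tendsto 0
        rw [mul_zero] at this
        exact this.mono_left nhdsWithin_le_nhds
      · filter_upwards [self_mem_nhdsWithin] with ε hε
        exact mul_pos hapos hε
    have key := (h.comp hscale).sub (h.const_mul ((a : ℂ) ^ μ))
    have hL : L - (a : ℂ) ^ μ * L = 0 := by
      refine ih (fun l => c l * ((a : ℂ) ^ l - (a : ℂ) ^ μ)) _ h0s (key.congr' ?_)
      filter_upwards [self_mem_nhdsWithin] with ε hε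
      have hm : ∀ l : ℂ, ((a * ε : ℝ) : ℂ) ^ l = (a : ℂ) ^ l * (ε : ℂ) ^ l := fun l => by
        rw [Complex.ofReal_mul, Complex.mul_cpow_ofReal_nonneg hapos.le (le_of_lt hε)]
      simp only [Function.comp, Finset.sum_insert hμ, hm, mul_add, Finset.mul_sum]
      rw [show ∀ A B C D : ℂ, A + B - (C + D) = (A - C) + (B - D) from fun _ _ _ _ => by ring,
        ← Finset.sum_sub_distrib]
      rw [show c μ * ((a : ℂ) ^ μ * (ε : ℂ) ^ μ) - (a : ℂ) ^ μ * (c μ * (ε : ℂ) ^ μ) = 0 by ring,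
        zero_add]
      exact Finset.sum_congr rfl fun l _ => by ring
    have : (1 - (a : ℂ) ^ μ) * L = 0 := by rw [← hL]; ring
    rcases mul_eq_zero.1 this with h1 | h1
    · exact absurd (sub_eq_zero.1 h1).symm hane
    · exact h1

theorem HasFinitePart.unique {Φ : ℝ → ℂ} {L M : ℂ} (hL : HasFinitePart Φ L)
    (hM : HasFinitePart Φ M) : L = M := by
  classical
  obtain ⟨s, c, hs, h⟩ := hL
  obtain ⟨t, d, ht, h'⟩ := hM
  have key := h'.sub h
  have h0 : (0 : ℂ) ∉ s ∪ t := by simp [hs, ht]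
  have := eq_zero_of_tendsto_sum_cpow (s ∪ t)
    (fun l => (if l ∈ s then c l else 0) - (if l ∈ t then d l else 0)) (M - L) h0
    (key.congr fun ε => by
      simp only [sub_mul, Finset.sum_sub_distrib, ite_mul, zero_mul, Finset.sum_ite_mem,
        Finset.union_inter_cancel_left, Finset.union_inter_cancel_right]
      ring)
  exact (sub_eq_zero.1 this).symm

theorem HasFPIntegral.fpIntegral_eq {φ : ℝ → ℂ} {x : ℝ} {L : ℂ} (h : HasFPIntegral φ x L) :
    fpIntegral φ x = L := by
  have hex : ∃ L, HasFPIntegral φ x L := ⟨L, h⟩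
  rw [fpIntegral, dif_pos hex]
  exact hex.choose_spec.2.unique h.2

theorem hasFPIntegral_of_intervalIntegrable {φ : ℝ → ℂ} {x : ℝ} (hx : 0 < x)
    (h : IntervalIntegrable φ volume 0 x) : HasFPIntegral φ x (∫ τ in (0 : ℝ)..x, φ τ) := by
  refine ⟨fun ε hε => h.mono_set ?_, ∅, 0, by simp, ?_⟩
  · rw [Set.uIcc_of_le hε.2.le, Set.uIcc_of_le hx.le]
    exact Set.Icc_subset_Icc_left hε.1.le
  · simp only [Finset.sum_empty, sub_zero]
    have hc : ContinuousOn (fun ε => ∫ τ in ε..x, φ τ) (Set.uIcc 0 x) := by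
      have h1 := intervalIntegral.continuousOn_primitive_interval'
        (a := x) (b₁ := 0) (b₂ := x) (f := φ) (μ := volume) h Set.right_mem_uIcc
      refine h1.neg.congr fun ε _ => ?_
      simp only [Pi.neg_apply]
      exact intervalIntegral.integral_symm _ _
    have h2 := hc 0 Set.left_mem_uIcc
    rw [Set.uIcc_of_le hx.le] at h2
    refine h2.tendsto.mono_left ?_
    rw [← nhdsWithin_Ioc_eq_nhdsGT hx]
    exact nhdsWithin_mono _ Set.Ioc_subset_Icc_self

end SubstantialCalculus

end

open SubstantialCalculus

/-!
Multiplication by `e^(-σx)` conjugates everything to the case `σ = 0`. There, Taylor expansion of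
the smooth factor splits `f` into finitely many powers `x^(q+β-1)` and a remainder which, extended
by `0` to the left, is smooth and vanishes to high order at `0`. The starting weights make the
corrected quadrature exact on the powers. On the remainder `F`, writing `F` as a superposition of
truncated powers `(x-s)_+^K` represents the error of the uncorrected quadrature by its Peano
kernel, the error for a truncated power. For `s` on the grid this is controlled by convergence of
order `p`; in between, the derivative of the error in the shift is the error for the power of one
degree less, so the bound follows by induction on the degree. The starting weights grow at most
like a power of `n`, and that growth is compensated by the order to which `F` vanishes at the
nodes `h, 2h, …, rh`.
-/

namespace SubstantialCalculus

/-! ### Finite parts -/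

theorem HasFinitePart.congr {Φ Ψ : ℝ → ℂ} {L : ℂ} (h : HasFinitePart Φ L)
    (hΦ : Φ =ᶠ[𝓝[>] 0] Ψ) : HasFinitePart Ψ L := by
  obtain ⟨s, c, hs, h⟩ := h
  exact ⟨s, c, hs, h.congr' (hΦ.mono fun ε hε => by simp only [hε])⟩

theorem HasFinitePart.const_mul {Φ : ℝ → ℂ} {L : ℂ} (a : ℂ) (h : HasFinitePart Φ L) :
    HasFinitePart (fun ε => a * Φ ε) (a * L) := by
  obtain ⟨s, c, hs, h⟩ := h
  refine ⟨s, fun l => a * c l, hs, (h.const_mul a).congr fun ε => ?_⟩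
  simp only [mul_sub, Finset.mul_sum, mul_assoc]

theorem HasFinitePart.add {Φ Ψ : ℝ → ℂ} {L M : ℂ} (hL : HasFinitePart Φ L)
    (hM : HasFinitePart Ψ M) : HasFinitePart (fun ε => Φ ε + Ψ ε) (L + M) := by
  classical
  obtain ⟨s, c, hs, h⟩ := hL
  obtain ⟨t, d, ht, h'⟩ := hM
  refine ⟨s ∪ t, fun l => (if l ∈ s then c l else 0) + (if l ∈ t then d l else 0), by simp [hs, ht],
    (h.add h').congr fun ε => ?_⟩
  simp only [add_mul, Finset.sum_add_distrib, ite_mul, zero_mul, Finset.sum_ite_mem,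
    Finset.union_inter_cancel_left, Finset.union_inter_cancel_right]
  ring

theorem hasFinitePart_of_tendsto {Φ : ℝ → ℂ} {L : ℂ} (h : Tendsto Φ (𝓝[>] 0) (𝓝 L)) :
    HasFinitePart Φ L :=
  ⟨∅, 0, by simp, by simpa using h⟩

theorem HasFinitePart.sum {ι : Type*} (s : Finset ι) {Φ : ι → ℝ → ℂ} {L : ι → ℂ}
    (h : ∀ i ∈ s, HasFinitePart (Φ i) (L i)) :
    HasFinitePart (fun ε => ∑ i ∈ s, Φ i ε) (∑ i ∈ s, L i) := by
  classical
  induction s using Finset.induction_on with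
  | empty => simpa using hasFinitePart_of_tendsto (tendsto_const_nhds (x := (0 : ℂ)))
  | insert i s hi ih =>
    simp only [Finset.sum_insert hi]
    exact (h i (by simp)).add (ih fun j hj => h j (by simp [hj]))

theorem hasFinitePart_cpow {z : ℂ} (hz : z ≠ 0) (a : ℂ) :
    HasFinitePart (fun ε : ℝ => a * (ε : ℂ) ^ z) 0 :=
  ⟨{z}, fun _ => a, by simpa using hz.symm, by simp⟩

theorem tendsto_cpow_mul_of_isLittleO {z : ℂ} {n : ℕ} (hn : -z.re < n) {ψ : ℝ → ℂ}
    (hψ : ψ =o[𝓝[>] 0] fun ε => ε ^ n) :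
    Tendsto (fun ε : ℝ => (ε : ℂ) ^ z * ψ ε) (𝓝[>] 0) (𝓝 0) := by
  have hpow : (fun ε : ℝ => (ε : ℂ) ^ z) =O[𝓝[>] 0] fun ε : ℝ => ε ^ z.re :=
    .of_norm_eventuallyLE <| by
      filter_upwards [self_mem_nhdsWithin] with ε hε
      exact (Complex.norm_cpow_eq_rpow_re_of_pos hε z).le
  have hone : (fun ε : ℝ => ε ^ z.re * ε ^ n) =O[𝓝[>] 0] fun _ : ℝ => (1 : ℝ) :=
    .of_norm_eventuallyLE <| by
      filter_upwards [Ioc_mem_nhdsGT (zero_lt_one (α := ℝ))] with ε hε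
      rw [← Real.rpow_natCast, ← Real.rpow_add hε.1,
        Real.norm_of_nonneg (Real.rpow_nonneg hε.1.le _)]
      exact Real.rpow_le_one hε.1.le hε.2 (by linarith)
  exact (Asymptotics.isLittleO_one_iff ℝ).1 ((hpow.mul_isLittleO hψ).trans_isBigO hone)

open scoped ContDiff in
theorem hasFinitePart_cpow_mul {z : ℂ} (hz : ∀ k : ℕ, z ≠ -(k : ℂ)) {φ : ℝ → ℂ} {b : ℝ}
    (hb : 0 < b) (hφ : ContDiffOn ℝ ∞ φ (Set.Icc 0 b)) :
    HasFinitePart (fun ε : ℝ => (ε : ℂ) ^ z * φ ε) 0 := by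
  obtain ⟨n, hn⟩ := exists_nat_gt (-z.re)
  have hle : 𝓝[>] (0 : ℝ) ≤ 𝓝[Set.Icc 0 b] 0 := by
    rw [← nhdsWithin_Ioc_eq_nhdsGT hb]
    exact nhdsWithin_mono _ Set.Ioc_subset_Icc_self
  have hrem : Tendsto (fun ε : ℝ => (ε : ℂ) ^ z * (φ ε - taylorWithinEval φ n (Set.Icc 0 b) 0 ε))
      (𝓝[>] 0) (𝓝 0) := by
    refine tendsto_cpow_mul_of_isLittleO hn ?_
    have := taylor_isLittleO (convex_Icc 0 b) (Set.left_mem_Icc.2 hb.le)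
      (hφ.of_le (by exact_mod_cast le_top) : ContDiffOn ℝ n φ _)
    simpa only [sub_zero] using this.mono hle
  have htaylor : HasFinitePart (fun ε : ℝ => ∑ k ∈ Finset.range (n + 1),
      ((Nat.factorial k : ℂ)⁻¹ * iteratedDerivWithin k φ (Set.Icc 0 b) 0) *
        (ε : ℂ) ^ (z + k)) (∑ _ ∈ Finset.range (n + 1), 0) :=
    HasFinitePart.sum _ fun k _ =>
      hasFinitePart_cpow (fun e => hz k (eq_neg_of_add_eq_zero_left e)) _
  have hadd := (hasFinitePart_of_tendsto hrem).add htaylor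
  rw [Finset.sum_const_zero, add_zero] at hadd
  refine hadd.congr ?_
  filter_upwards [self_mem_nhdsWithin] with ε hε
  have hε' : (ε : ℂ) ≠ 0 := by exact_mod_cast (ne_of_gt hε)
  rw [taylor_within_apply, mul_sub, sub_add, sub_eq_self, sub_eq_zero, Finset.mul_sum]
  refine Finset.sum_congr rfl fun k _ => ?_
  rw [Complex.cpow_add _ _ hε', Complex.cpow_natCast, Complex.real_smul]
  push_cast
  rw [sub_zero]
  ring

section FPIntegral

variable {φ ψ : ℝ → ℂ} {x : ℝ} {L M : ℂ}

theorem HasFPIntegral.congr (h : HasFPIntegral φ x L) (hx : 0 < x)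
    (hφ : Set.EqOn φ ψ (Set.Ioc 0 x)) : HasFPIntegral ψ x L := by
  refine ⟨fun ε hε => (h.1 ε hε).congr fun τ hτ => ?_, h.2.congr ?_⟩
  · rw [Set.uIoc_of_le hε.2.le] at hτ
    exact hφ ⟨hε.1.trans hτ.1, hτ.2⟩
  · filter_upwards [Ioo_mem_nhdsGT hx] with ε hε
    refine intervalIntegral.integral_congr fun τ hτ => ?_
    rw [Set.uIcc_of_le hε.2.le] at hτ
    exact hφ ⟨hε.1.trans_le hτ.1, hτ.2⟩

theorem HasFPIntegral.const_mul (a : ℂ) (h : HasFPIntegral φ x L) :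
    HasFPIntegral (fun τ => a * φ τ) x (a * L) := by
  refine ⟨fun ε hε => (h.1 ε hε).const_mul a, ?_⟩
  simp only [intervalIntegral.integral_const_mul]
  exact h.2.const_mul a

theorem HasFPIntegral.add (hx : 0 < x) (h : HasFPIntegral φ x L) (h' : HasFPIntegral ψ x M) :
    HasFPIntegral (fun τ => φ τ + ψ τ) x (L + M) := by
  refine ⟨fun ε hε => (h.1 ε hε).add (h'.1 ε hε), (h.2.add h'.2).congr ?_⟩
  filter_upwards [Ioo_mem_nhdsGT hx] with ε hε
  exact (intervalIntegral.integral_add (h.1 ε hε) (h'.1 ε hε)).symm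

theorem hasFPIntegral_of_hasDerivAt {Ψ : ℝ → ℂ} (hx : 0 < x)
    (hcont : ContinuousOn Ψ (Set.Ioc 0 x)) (hderiv : ∀ τ ∈ Set.Ioo 0 x, HasDerivAt Ψ (ψ τ) τ)
    (hint : ∀ ε ∈ Set.Ioo 0 x, IntervalIntegrable ψ volume ε x) (hΨ : HasFinitePart Ψ L) :
    HasFPIntegral ψ x (Ψ x - L) := by
  refine ⟨hint, ?_⟩
  have hpart := (hasFinitePart_of_tendsto (tendsto_const_nhds (x := Ψ x))).add (hΨ.const_mul (-1))
  rw [neg_one_mul, ← sub_eq_add_neg] at hpart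
  refine hpart.congr ?_
  filter_upwards [Ioo_mem_nhdsGT hx] with ε hε
  rw [intervalIntegral.integral_eq_sub_of_hasDerivAt_of_le hε.2.le
    (hcont.mono fun τ hτ => ⟨hε.1.trans_le hτ.1, hτ.2⟩)
    (fun τ hτ => hderiv τ ⟨hε.1.trans hτ.1, hτ.2⟩) (hint ε hε)]
  ring

end FPIntegral

/-! ### Riemann–Liouville integrals of powers -/

/-- The Riemann–Liouville integral of order `a` of the power `x ^ (z - 1)`. It is `0` where `z + a`
is a pole of `Γ`, since `Complex.Gamma` takes the value `0` there. -/
noncomputable def rlPower (a z : ℂ) (x : ℝ) : ℂ :=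
  Complex.Gamma z / Complex.Gamma (z + a) * (x : ℂ) ^ (z + a - 1)

theorem cpow_sub_one_mul_self {a : ℂ} (ha : a ≠ 0) (z : ℂ) : a ^ (z - 1) * a = a ^ z := by
  rw [Complex.cpow_sub _ _ ha, Complex.cpow_one, div_mul_cancel₀ _ ha]

theorem hasDerivAt_ofReal_cpow_of_ne_zero {x : ℝ} (hx : x ≠ 0) (z : ℂ) :
    HasDerivAt (fun x : ℝ => (x : ℂ) ^ z) (z * (x : ℂ) ^ (z - 1)) x := by
  rcases eq_or_ne z 0 with rfl | hz
  · simpa using hasDerivAt_const x (1 : ℂ)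
  · exact hasDerivAt_ofReal_cpow_const hx hz

theorem contDiffOn_ofReal_cpow (n : ℕ) (z : ℂ) :
    ContDiffOn ℝ n (fun x : ℝ => (x : ℂ) ^ z) (Set.Ioi 0) := by
  have hexp : ContDiffOn ℝ n (fun x : ℝ => Complex.exp ((Real.log x : ℂ) * z)) (Set.Ioi 0) :=
    (Complex.contDiff_exp (𝕜 := ℝ)).comp_contDiffOn
      ((Complex.ofRealCLM.contDiff.comp_contDiffOn
        (Real.contDiffOn_log.mono fun _ hx => ne_of_gt hx)).mul contDiffOn_const)
  refine hexp.congr fun x hx => ?_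
  rw [Complex.cpow_def_of_ne_zero (Complex.ofReal_ne_zero.2 (ne_of_gt hx)),
    ← Complex.ofReal_log (le_of_lt hx)]

theorem rlPower_recurrence (a : ℂ) {z : ℂ} (hz : z ≠ 0) {x : ℝ} (hx : x ≠ 0) :
    z * x * rlPower a z x = (z + a) * rlPower a (z + 1) x := by
  rw [rlPower, rlPower, Complex.Gamma_add_one _ hz, div_eq_mul_inv (Complex.Gamma z),
    Complex.one_div_Gamma_eq_self_mul_one_div_Gamma_add_one (z + a),
    add_right_comm z 1 a, add_sub_cancel_right,
    ← cpow_sub_one_mul_self (Complex.ofReal_ne_zero.2 hx) (z + a)]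
  ring

theorem hasDerivAt_rlPower (a z : ℂ) {x : ℝ} (hx : x ≠ 0) :
    HasDerivAt (rlPower (a + 1) z) (rlPower a z x) x := by
  refine ((hasDerivAt_ofReal_cpow_of_ne_zero hx (z + (a + 1) - 1)).const_mul
    (Complex.Gamma z / Complex.Gamma (z + (a + 1)))).congr_deriv ?_
  rw [rlPower, div_eq_mul_inv, div_eq_mul_inv,
    Complex.one_div_Gamma_eq_self_mul_one_div_Gamma_add_one (z + a),
    ← add_assoc, add_sub_cancel_right]
  ring

theorem rlPower_mul (a z : ℂ) {x h : ℝ} (hx : 0 ≤ x) (hh : 0 ≤ h) :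
    rlPower a z (x * h) = (h : ℂ) ^ (z + a - 1) * rlPower a z x := by
  rw [rlPower, rlPower, Complex.ofReal_mul, Complex.mul_cpow_ofReal_nonneg hx hh]
  ring

theorem intervalIntegrable_rpow_sub {ν : ℝ} (hν : 0 < ν) (a b x : ℝ) :
    IntervalIntegrable (fun τ : ℝ => (((x - τ) ^ (ν - 1) : ℝ) : ℂ)) volume a b := by
  have h := (intervalIntegral.intervalIntegrable_rpow' (a := x - a) (b := x - b)
    (by linarith : -1 < ν - 1)).comp_sub_left x
  simp only [sub_sub_cancel] at h
  exact ⟨h.1.ofReal, h.2.ofReal⟩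

theorem intervalIntegrable_rpow_sub_mul_cpow {ν : ℝ} (hν : 0 < ν) {ε x : ℝ} (hε : 0 < ε)
    (hεx : ε ≤ x) (z : ℂ) :
    IntervalIntegrable (fun τ : ℝ => (((x - τ) ^ (ν - 1) : ℝ) : ℂ) * (τ : ℂ) ^ z)
      volume ε x := by
  refine (intervalIntegrable_rpow_sub hν ε x x).mul_continuousOn fun τ hτ => ?_
  rw [Set.uIcc_of_le hεx] at hτ
  exact (Complex.continuousAt_ofReal_cpow_const _ _
    (Or.inr (hε.trans_le hτ.1).ne')).continuousWithinAt

theorem hasFPIntegral_rpow_sub_mul_cpow_of_re_pos {ν : ℝ} (hν : 0 < ν) {x : ℝ} (hx : 0 < x) {z : ℂ}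
    (hz : 0 < z.re) :
    HasFPIntegral (fun τ : ℝ => (((x - τ) ^ (ν - 1) : ℝ) : ℂ) * (τ : ℂ) ^ (z - 1)) x
      (Real.Gamma ν * rlPower ν z x) := by
  have hint : IntervalIntegrable
      (fun τ : ℝ => (((x - τ) ^ (ν - 1) : ℝ) : ℂ) * (τ : ℂ) ^ (z - 1)) volume 0 x := by
    have hhalf : 0 < x / 2 := half_pos hx
    refine IntervalIntegrable.trans ?_
      (intervalIntegrable_rpow_sub_mul_cpow hν hhalf (half_le_self hx.le) (z - 1))
    refine (intervalIntegral.intervalIntegrable_cpow' (by simpa using hz)).continuousOn_mul ?_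
    rw [Set.uIcc_of_le hhalf.le]
    refine Complex.continuous_ofReal.comp_continuousOn
      ((continuousOn_const.sub continuousOn_id).rpow_const fun τ hτ => Or.inl (sub_pos.2 ?_).ne')
    exact hτ.2.trans_lt (half_lt_self hx)
  convert hasFPIntegral_of_intervalIntegrable hx hint using 1
  have hbeta := Complex.betaIntegral_scaled z ν hx
  rw [Complex.betaIntegral_eq_Gamma_mul_div _ _ hz (by simpa using hν)] at hbeta
  rw [rlPower, ← Complex.Gamma_ofReal, show ∀ a b c d : ℂ, a * (b / c * d) = d * (b * a / c) from
    fun _ _ _ _ => by ring, ← hbeta]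
  refine intervalIntegral.integral_congr fun τ hτ => ?_
  rw [Set.uIcc_of_le hx.le] at hτ
  rw [Complex.ofReal_cpow (sub_nonneg.2 hτ.2), mul_comm]
  push_cast
  rfl

theorem hasDerivAt_cpow_mul_rpow_sub (z : ℂ) (ν : ℝ) {x τ : ℝ} (hτ : 0 < τ) (hτx : τ < x) :
    HasDerivAt (fun τ : ℝ => (τ : ℂ) ^ z * (((x - τ) ^ ν : ℝ) : ℂ))
      (z * x * ((((x - τ) ^ (ν - 1) : ℝ) : ℂ) * (τ : ℂ) ^ (z - 1)) -
        (z + ν) * ((((x - τ) ^ (ν - 1) : ℝ) : ℂ) * (τ : ℂ) ^ (z + 1 - 1))) τ := by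
  have hrpow : HasDerivAt (fun τ : ℝ => (((x - τ) ^ ν : ℝ) : ℂ))
      (((-1 * ν * (x - τ) ^ (ν - 1) : ℝ)) : ℂ) τ :=
    (((hasDerivAt_id τ).const_sub x).rpow_const (Or.inl (sub_pos.2 hτx).ne')).ofReal_comp
  refine ((hasDerivAt_ofReal_cpow_of_ne_zero hτ.ne' z).mul hrpow).congr_deriv ?_
  have hν : (x - τ) ^ ν = (x - τ) ^ (ν - 1) * (x - τ) := by
    rw [← Real.rpow_add_one (sub_pos.2 hτx).ne', sub_add_cancel]
  rw [add_sub_cancel_right, hν, ← cpow_sub_one_mul_self (Complex.ofReal_ne_zero.2 hτ.ne') z]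
  push_cast
  ring

theorem hasFPIntegral_rpow_sub_mul_cpow_recurrence {ν : ℝ} (hν : 0 < ν) {x : ℝ} (hx : 0 < x)
    {z : ℂ} (hz : ∀ k : ℕ, z ≠ -(k : ℂ)) :
    HasFPIntegral (fun τ : ℝ => z * x * ((((x - τ) ^ (ν - 1) : ℝ) : ℂ) * (τ : ℂ) ^ (z - 1)) -
        (z + ν) * ((((x - τ) ^ (ν - 1) : ℝ) : ℂ) * (τ : ℂ) ^ (z + 1 - 1))) x 0 := by
  have hfp : HasFinitePart (fun τ : ℝ => (τ : ℂ) ^ z * (((x - τ) ^ ν : ℝ) : ℂ)) 0 := by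
    refine hasFinitePart_cpow_mul hz (half_pos hx) ?_
    refine Complex.ofRealCLM.contDiff.comp_contDiffOn fun τ hτ => ContDiffAt.contDiffWithinAt ?_
    exact (contDiffAt_const.sub contDiffAt_id).rpow_const_of_ne
      (sub_pos.2 (hτ.2.trans_lt (half_lt_self hx))).ne'
  have hcont : ContinuousOn (fun τ : ℝ => (τ : ℂ) ^ z * (((x - τ) ^ ν : ℝ) : ℂ))
      (Set.Ioc 0 x) := fun τ hτ =>
    ((Complex.continuousAt_ofReal_cpow_const _ _ (Or.inr hτ.1.ne')).mul
      (Complex.continuous_ofReal.continuousAt.comp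
        ((continuousAt_const.sub continuousAt_id).rpow_const (Or.inr hν.le)))).continuousWithinAt
  have h := hasFPIntegral_of_hasDerivAt hx hcont
    (fun τ hτ => hasDerivAt_cpow_mul_rpow_sub z ν hτ.1 hτ.2)
    (fun ε hε => ((intervalIntegrable_rpow_sub_mul_cpow hν hε.1 hε.2.le _).const_mul _).sub
      ((intervalIntegrable_rpow_sub_mul_cpow hν hε.1 hε.2.le _).const_mul _)) hfp
  rwa [sub_self, Real.zero_rpow hν.ne', Complex.ofReal_zero, mul_zero, sub_zero] at h

theorem hasFPIntegral_rpow_sub_mul_cpow {ν : ℝ} (hν : 0 < ν) {x : ℝ} (hx : 0 < x) {z : ℂ}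
    (hz : ∀ k : ℕ, z ≠ -(k : ℂ)) :
    HasFPIntegral (fun τ : ℝ => (((x - τ) ^ (ν - 1) : ℝ) : ℂ) * (τ : ℂ) ^ (z - 1)) x
      (Real.Gamma ν * rlPower ν z x) := by
  obtain ⟨n, hn⟩ := exists_nat_gt (-z.re)
  induction n generalizing z with
  | zero => exact hasFPIntegral_rpow_sub_mul_cpow_of_re_pos hν hx (by simpa using hn)
  | succ n ih =>
    have hz0 : z ≠ 0 := by simpa using hz 0
    have hzx : z * (x : ℂ) ≠ 0 := mul_ne_zero hz0 (Complex.ofReal_ne_zero.2 hx.ne')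
    have hnext := ih (z := z + 1)
      (fun k e => hz (k + 1) (by push_cast; linear_combination e))
      (by rw [Complex.add_re, Complex.one_re]; push_cast at hn; linarith)
    have h := ((hasFPIntegral_rpow_sub_mul_cpow_recurrence hν hx hz).add hx
      (hnext.const_mul (z + ν))).const_mul (z * x)⁻¹
    convert h using 1
    · funext τ
      rw [sub_add_cancel, inv_mul_cancel_left₀ hzx]
    · rw [zero_add, mul_left_comm (z + ν : ℂ), ← rlPower_recurrence _ hz0 hx.ne',
        mul_left_comm (Real.Gamma ν : ℂ), inv_mul_cancel_left₀ hzx]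

/-! ### Riemann–Liouville integrals of functions that vanish on the negative axis -/

/-- The Riemann–Liouville integral of order `ν > 0` with lower terminal `0`. -/
noncomputable def rlIntegral (ν : ℝ) (F : ℝ → ℂ) (x : ℝ) : ℂ :=
  ((1 / Real.Gamma ν : ℝ) : ℂ) * ∫ s in (0 : ℝ)..x, (((x - s) ^ (ν - 1) : ℝ) : ℂ) * F s

section ParametricConvolution

variable {κ F : ℝ → ℂ} {b : ℝ}

theorem exists_bound_comp_sub (hF : Continuous F) (b x : ℝ) :
    ∃ M, ∀ u ∈ Set.uIoc 0 b, ∀ y ∈ Set.Icc (x - 1) (x + 1), ‖F (y - u)‖ ≤ M := by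
  obtain ⟨M, hM⟩ := (isCompact_uIcc.prod isCompact_Icc).exists_bound_of_continuousOn
    (s := Set.uIcc 0 b ×ˢ Set.Icc (x - 1) (x + 1)) (f := fun q : ℝ × ℝ => F (q.2 - q.1))
    (by fun_prop)
  exact ⟨M, fun u hu y hy => hM (u, y) ⟨Set.uIoc_subset_uIcc hu, hy⟩⟩

theorem intervalIntegrable_mul_comp_sub (hκ : IntervalIntegrable κ volume 0 b) (hF : Continuous F)
    (y : ℝ) : IntervalIntegrable (fun u => κ u * F (y - u)) volume 0 b :=
  hκ.mul_continuousOn (hF.comp (continuous_const.sub continuous_id)).continuousOn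

theorem continuous_integral_mul_comp_sub (hκ : IntervalIntegrable κ volume 0 b)
    (hF : Continuous F) : Continuous fun y => ∫ u in (0 : ℝ)..b, κ u * F (y - u) := by
  refine continuous_iff_continuousAt.2 fun x => ?_
  obtain ⟨M, hM⟩ := exists_bound_comp_sub hF b x
  refine intervalIntegral.continuousAt_of_dominated_interval (bound := fun u => ‖κ u‖ * M)
    (Eventually.of_forall fun y =>
      (intervalIntegrable_mul_comp_sub hκ hF y).def'.aestronglyMeasurable) ?_
    (hκ.norm.mul_const M) (ae_of_all _ fun u _ => by fun_prop)
  filter_upwards [Icc_mem_nhds (sub_one_lt x) (lt_add_one x)] with y hy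
  refine ae_of_all _ fun u hu => ?_
  rw [norm_mul]
  exact mul_le_mul_of_nonneg_left (hM u hu y hy) (norm_nonneg _)

theorem hasDerivAt_integral_mul_comp_sub (hκ : IntervalIntegrable κ volume 0 b)
    (hF : ContDiff ℝ 1 F) (x : ℝ) :
    HasDerivAt (fun y => ∫ u in (0 : ℝ)..b, κ u * F (y - u))
      (∫ u in (0 : ℝ)..b, κ u * deriv F (x - u)) x := by
  have hF' : Continuous (deriv F) := hF.continuous_deriv le_rfl
  obtain ⟨M, hM⟩ := exists_bound_comp_sub hF' b x
  refine (intervalIntegral.hasDerivAt_integral_of_dominated_loc_of_deriv_le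
    (F' := fun y u => κ u * deriv F (y - u)) (bound := fun u => ‖κ u‖ * M)
    (Icc_mem_nhds (sub_one_lt x) (lt_add_one x))
    (Eventually.of_forall fun y =>
      (intervalIntegrable_mul_comp_sub hκ hF.continuous y).def'.aestronglyMeasurable)
    (intervalIntegrable_mul_comp_sub hκ hF.continuous x)
    (intervalIntegrable_mul_comp_sub hκ hF' x).def'.aestronglyMeasurable
    (ae_of_all _ fun u hu y hy => ?_) (hκ.norm.mul_const M)
    (ae_of_all _ fun u _ y _ => ?_)).2
  · rw [norm_mul]
    exact mul_le_mul_of_nonneg_left (hM u hu y hy) (norm_nonneg _)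
  · exact ((hF.differentiable one_ne_zero _).hasDerivAt.comp_sub_const y u).const_mul _

end ParametricConvolution

section VanishingOnNonpos

variable {F : ℝ → ℂ} {k : ℕ}

theorem deriv_eq_zero_of_nonpos (hF : ContDiff ℝ 1 F) (h0 : ∀ x ≤ 0, F x = 0) :
    ∀ x ≤ 0, deriv F x = 0 := by
  have hneg : Set.EqOn (deriv F) 0 (Set.Iio 0) := fun x hx => by
    have hzero : F =ᶠ[𝓝 x] fun _ => 0 := by
      filter_upwards [Iio_mem_nhds hx] with y hy using h0 y (le_of_lt hy)
    rw [hzero.deriv_eq, deriv_const, Pi.zero_apply]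
  have hclosure := hneg.closure (hF.continuous_deriv le_rfl) continuous_const
  rw [closure_Iio] at hclosure
  exact fun x hx => hclosure hx

theorem contDiff_deriv_of_succ (hF : ContDiff ℝ (k + 1 : ℕ) F) : ContDiff ℝ k (deriv F) :=
  (contDiff_succ_iff_deriv.1 (by exact_mod_cast hF)).2.2

theorem contDiff_one_of_succ (hF : ContDiff ℝ (k + 1 : ℕ) F) : ContDiff ℝ 1 F :=
  hF.of_le (by norm_cast; omega)

theorem iteratedDeriv_eq_zero_of_nonpos (hF : ContDiff ℝ k F) (h0 : ∀ x ≤ 0, F x = 0) :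
    ∀ x ≤ 0, iteratedDeriv k F x = 0 := by
  induction k generalizing F with
  | zero => simpa using h0
  | succ k ih =>
    rw [iteratedDeriv_succ']
    exact ih (contDiff_deriv_of_succ hF) (deriv_eq_zero_of_nonpos (contDiff_one_of_succ hF) h0)

end VanishingOnNonpos

section RLIntegral

variable {ν : ℝ} {F : ℝ → ℂ} {k : ℕ}

theorem intervalIntegrable_rpow_sub_mul (hν : 0 < ν) (hF : Continuous F) (a b x : ℝ) :
    IntervalIntegrable (fun s : ℝ => (((x - s) ^ (ν - 1) : ℝ) : ℂ) * F s) volume a b :=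
  (intervalIntegrable_rpow_sub hν a b x).mul_continuousOn hF.continuousOn

theorem intervalIntegrable_ofReal_rpow (hν : 0 < ν) (a b : ℝ) :
    IntervalIntegrable (fun u : ℝ => ((u ^ (ν - 1) : ℝ) : ℂ)) volume a b :=
  have h := intervalIntegral.intervalIntegrable_rpow' (a := a) (b := b) (by linarith : -1 < ν - 1)
  ⟨h.1.ofReal, h.2.ofReal⟩

theorem rlIntegral_eq_integral_comp_sub (hν : 0 < ν) (hF : Continuous F)
    (h0 : ∀ x ≤ 0, F x = 0) {x b : ℝ} (hxb : x ≤ b) :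
    rlIntegral ν F x =
      ((1 / Real.Gamma ν : ℝ) : ℂ) * ∫ u in (0 : ℝ)..b, ((u ^ (ν - 1) : ℝ) : ℂ) * F (x - u) := by
  have hint : ∀ a b, IntervalIntegrable (fun u : ℝ => ((u ^ (ν - 1) : ℝ) : ℂ) * F (x - u))
      volume a b := fun a b => (intervalIntegrable_ofReal_rpow hν a b).mul_continuousOn
    (hF.comp (continuous_const.sub continuous_id)).continuousOn
  have htail : ∫ u in x..b, ((u ^ (ν - 1) : ℝ) : ℂ) * F (x - u) = 0 := by
    refine intervalIntegral.integral_zero_ae (ae_of_all _ fun u hu => ?_)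
    rw [Set.uIoc_of_le hxb] at hu
    rw [h0 _ (sub_nonpos.2 hu.1.le), mul_zero]
  have hsub := intervalIntegral.integral_comp_sub_left (a := 0) (b := x)
    (fun s : ℝ => (((x - s) ^ (ν - 1) : ℝ) : ℂ) * F s) x
  rw [sub_self, sub_zero] at hsub
  rw [rlIntegral, ← intervalIntegral.integral_add_adjacent_intervals (hint 0 x) (hint x b), htail,
    add_zero, ← hsub]
  simp only [sub_sub_cancel]

theorem rlIntegral_eventuallyEq (hν : 0 < ν) (hF : Continuous F) (h0 : ∀ x ≤ 0, F x = 0) (x : ℝ) :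
    rlIntegral ν F =ᶠ[𝓝 x] fun y => ((1 / Real.Gamma ν : ℝ) : ℂ) *
      ∫ u in (0 : ℝ)..(x + 1), ((u ^ (ν - 1) : ℝ) : ℂ) * F (y - u) := by
  filter_upwards [Iio_mem_nhds (lt_add_one x)] with y hy
  exact rlIntegral_eq_integral_comp_sub hν hF h0 (le_of_lt hy)

theorem continuous_rlIntegral (hν : 0 < ν) (hF : Continuous F) (h0 : ∀ x ≤ 0, F x = 0) :
    Continuous (rlIntegral ν F) :=
  continuous_iff_continuousAt.2 fun x =>
    (continuousAt_const.mul (continuous_integral_mul_comp_sub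
      (intervalIntegrable_ofReal_rpow hν 0 (x + 1)) hF).continuousAt).congr
      (rlIntegral_eventuallyEq hν hF h0 x).symm

theorem hasDerivAt_rlIntegral (hν : 0 < ν) (hF : ContDiff ℝ 1 F) (h0 : ∀ x ≤ 0, F x = 0) (x : ℝ) :
    HasDerivAt (rlIntegral ν F) (rlIntegral ν (deriv F) x) x := by
  rw [(rlIntegral_eventuallyEq hν (hF.continuous_deriv le_rfl)
    (deriv_eq_zero_of_nonpos hF h0) x).eq_of_nhds]
  exact ((hasDerivAt_integral_mul_comp_sub (intervalIntegrable_ofReal_rpow hν 0 (x + 1))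
    hF x).const_mul _).congr_of_eventuallyEq (rlIntegral_eventuallyEq hν hF.continuous h0 x)

theorem deriv_rlIntegral (hν : 0 < ν) (hF : ContDiff ℝ 1 F) (h0 : ∀ x ≤ 0, F x = 0) :
    deriv (rlIntegral ν F) = rlIntegral ν (deriv F) :=
  funext fun x => (hasDerivAt_rlIntegral hν hF h0 x).deriv

theorem contDiff_rlIntegral (hν : 0 < ν) (hF : ContDiff ℝ k F) (h0 : ∀ x ≤ 0, F x = 0) :
    ContDiff ℝ k (rlIntegral ν F) := by
  induction k generalizing F with
  | zero => exact contDiff_zero.2 (continuous_rlIntegral hν hF.continuous h0)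
  | succ k ih =>
    have hF1 := contDiff_one_of_succ hF
    have hsucc : ContDiff ℝ ((k : ℕ) + 1) (rlIntegral ν F) := contDiff_succ_iff_deriv.2
      ⟨fun x => (hasDerivAt_rlIntegral hν hF1 h0 x).differentiableAt,
        fun h => absurd h (by simp), by
        rw [deriv_rlIntegral hν hF1 h0]
        exact ih (contDiff_deriv_of_succ hF) (deriv_eq_zero_of_nonpos hF1 h0)⟩
    exact_mod_cast hsucc

theorem iteratedDeriv_rlIntegral (hν : 0 < ν) (hF : ContDiff ℝ k F) (h0 : ∀ x ≤ 0, F x = 0) :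
    iteratedDeriv k (rlIntegral ν F) = rlIntegral ν (iteratedDeriv k F) := by
  induction k generalizing F with
  | zero => simp only [iteratedDeriv_zero]
  | succ k ih =>
    have hF1 := contDiff_one_of_succ hF
    rw [iteratedDeriv_succ', iteratedDeriv_succ', deriv_rlIntegral hν hF1 h0,
      ih (contDiff_deriv_of_succ hF) (deriv_eq_zero_of_nonpos hF1 h0)]

theorem rlIntegral_eq_rlIntegral_add_one_deriv (hν : 0 < ν) (hF : ContDiff ℝ 1 F) (h0 : F 0 = 0)
    {x : ℝ} (hx : 0 ≤ x) : rlIntegral ν F x = rlIntegral (ν + 1) (deriv F) x := by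
  have hcont : Continuous fun s : ℝ => ((-((x - s) ^ ν / ν) : ℝ) : ℂ) :=
    Complex.continuous_ofReal.comp (Continuous.neg (Continuous.div_const
      ((continuous_const.sub continuous_id).rpow_const fun _ => Or.inr hν.le) _))
  have hderiv : ∀ s ∈ Set.Ioo (min 0 x) (max 0 x),
      HasDerivAt (fun s : ℝ => ((-((x - s) ^ ν / ν) : ℝ) : ℂ)) (((x - s) ^ (ν - 1) : ℝ) : ℂ) s := by
    intro s hs
    rw [min_eq_left hx, max_eq_right hx] at hs
    refine ((((hasDerivAt_id s).const_sub x).rpow_const (p := ν)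
      (Or.inl (sub_pos.2 hs.2).ne')).div_const ν).neg.ofReal_comp.congr_deriv (congrArg _ ?_)
    simp only [id]
    field_simp
  have hparts := intervalIntegral.integral_mul_deriv_eq_deriv_mul_of_hasDerivAt
    hF.continuous.continuousOn hcont.continuousOn
    (fun s _ => (hF.differentiable one_ne_zero _).hasDerivAt) hderiv
    ((hF.continuous_deriv le_rfl).intervalIntegrable _ _) (intervalIntegrable_rpow_sub hν 0 x x)
  rw [sub_self, Real.zero_rpow hν.ne', h0, zero_div, neg_zero, Complex.ofReal_zero, mul_zero,
    zero_mul, sub_zero, zero_sub, ← intervalIntegral.integral_neg] at hparts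
  have hν' : (ν : ℂ) ≠ 0 := Complex.ofReal_ne_zero.2 hν.ne'
  simp only [rlIntegral, Real.Gamma_add_one hν.ne', add_sub_cancel_right,
    mul_comm _ (F _), hparts, ← intervalIntegral.integral_const_mul]
  refine intervalIntegral.integral_congr fun s _ => ?_
  push_cast
  field_simp

theorem rlIntegral_eq_rlIntegral_iteratedDeriv (hν : 0 < ν) (hF : ContDiff ℝ k F)
    (h0 : ∀ x ≤ 0, F x = 0) {x : ℝ} (hx : 0 ≤ x) :
    rlIntegral ν F x = rlIntegral (ν + k) (iteratedDeriv k F) x := by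
  induction k generalizing F ν with
  | zero => simp
  | succ k ih =>
    have hF1 := contDiff_one_of_succ hF
    rw [rlIntegral_eq_rlIntegral_add_one_deriv hν hF1 (h0 0 le_rfl) hx,
      ih (by positivity) (contDiff_deriv_of_succ hF) (deriv_eq_zero_of_nonpos hF1 h0),
      iteratedDeriv_succ', Nat.cast_add_one, add_assoc, add_comm (1 : ℝ)]

/-- Taylor's formula with integral remainder at a point where all derivatives vanish. -/
theorem eq_rlIntegral_iteratedDeriv (hk : k ≠ 0) (hF : ContDiff ℝ k F) (h0 : ∀ x ≤ 0, F x = 0)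
    {x : ℝ} (hx : 0 ≤ x) : F x = rlIntegral k (iteratedDeriv k F) x := by
  obtain ⟨k, rfl⟩ := Nat.exists_eq_succ_of_ne_zero hk
  have hF1 := contDiff_one_of_succ hF
  have hftc : F x = rlIntegral 1 (deriv F) x := by
    have := intervalIntegral.integral_eq_sub_of_hasDerivAt (a := 0) (b := x)
      (fun s _ => (hF1.differentiable one_ne_zero s).hasDerivAt)
      ((hF1.continuous_deriv le_rfl).intervalIntegrable _ _)
    simp [rlIntegral, this, h0]
  rw [hftc, rlIntegral_eq_rlIntegral_iteratedDeriv one_pos (contDiff_deriv_of_succ hF)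
    (deriv_eq_zero_of_nonpos hF1 h0) hx, iteratedDeriv_succ', Nat.cast_succ, add_comm (1 : ℝ)]

end RLIntegral

/-! ### Riemann–Liouville differintegrals -/

/-- On `(0, ∞)`, the finite part Riemann–Liouville integral of order `ν` of `f` exists and is
`u`. -/
def HasRLIntegral (ν : ℝ) (f u : ℝ → ℂ) : Prop :=
  ∀ x : ℝ, 0 < x →
    HasFPIntegral (fun τ => (((x - τ) ^ (ν - 1) : ℝ) : ℂ) * f τ) x (Real.Gamma ν * u x)

/-- On `(0, ∞)`, the Riemann–Liouville integral of order `α` (for `α < 0`: derivative of order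
`-α`) of `f` exists and is `g`. This is the case `σ = 0` of `I_s^α f = g`, to which the general case
is reduced by `HasRLDifferintegral.substOp_exp_mul`. -/
structure HasRLDifferintegral (α : ℝ) (f g : ℝ → ℂ) : Prop where
  of_pos : 0 < α → HasRLIntegral α f g
  of_zero : α = 0 → Set.EqOn f g (Set.Ioi 0)
  of_neg : α < 0 → ∃ u, HasRLIntegral (derivOrder (-α) + α) f u ∧
    ContDiffOn ℝ (derivOrder (-α)) u (Set.Ioi 0) ∧
    Set.EqOn (iteratedDeriv (derivOrder (-α)) u) g (Set.Ioi 0)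

section Linearity

variable {α ν : ℝ} {f f' g g' u v : ℝ → ℂ}

theorem HasRLIntegral.congr (h : HasRLIntegral ν f u) (hf : Set.EqOn f f' (Set.Ioi 0)) :
    HasRLIntegral ν f' u := fun x hx =>
  (h x hx).congr hx fun τ hτ => by simp only [hf hτ.1]

theorem HasRLIntegral.add (h : HasRLIntegral ν f u) (h' : HasRLIntegral ν f' v) :
    HasRLIntegral ν (fun x => f x + f' x) fun x => u x + v x := fun x hx => by
  simpa only [mul_add] using (h x hx).add hx (h' x hx)

theorem HasRLIntegral.const_mul (a : ℂ) (h : HasRLIntegral ν f u) :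
    HasRLIntegral ν (fun x => a * f x) fun x => a * u x := fun x hx => by
  simpa only [mul_left_comm a] using (h x hx).const_mul a

theorem HasRLDifferintegral.congr (h : HasRLDifferintegral α f g)
    (hf : Set.EqOn f f' (Set.Ioi 0)) : HasRLDifferintegral α f' g where
  of_pos hα := (h.of_pos hα).congr hf
  of_zero hα := hf.symm.trans (h.of_zero hα)
  of_neg hα := by
    obtain ⟨u, hu, hrest⟩ := h.of_neg hα
    exact ⟨u, hu.congr hf, hrest⟩

theorem HasRLDifferintegral.add (h : HasRLDifferintegral α f g)
    (h' : HasRLDifferintegral α f' g') :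
    HasRLDifferintegral α (fun x => f x + f' x) fun x => g x + g' x where
  of_pos hα := (h.of_pos hα).add (h'.of_pos hα)
  of_zero hα x hx := congrArg₂ (· + ·) (h.of_zero hα hx) (h'.of_zero hα hx)
  of_neg hα := by
    obtain ⟨u, hu, hud, hug⟩ := h.of_neg hα
    obtain ⟨v, hv, hvd, hvg⟩ := h'.of_neg hα
    refine ⟨fun x => u x + v x, hu.add hv, hud.add hvd, fun x hx => ?_⟩
    rw [iteratedDeriv_fun_add (hud.contDiffAt (Ioi_mem_nhds hx)) (hvd.contDiffAt (Ioi_mem_nhds hx)),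
      hug hx, hvg hx]

theorem HasRLDifferintegral.const_mul (a : ℂ) (h : HasRLDifferintegral α f g) :
    HasRLDifferintegral α (fun x => a * f x) fun x => a * g x where
  of_pos hα := (h.of_pos hα).const_mul a
  of_zero hα x hx := congrArg (a * ·) (h.of_zero hα hx)
  of_neg hα := by
    obtain ⟨u, hu, hud, hug⟩ := h.of_neg hα
    refine ⟨fun x => a * u x, hu.const_mul a, contDiffOn_const.mul hud, fun x hx => ?_⟩
    rw [iteratedDeriv_const_mul_field, hug hx]

theorem HasRLDifferintegral.sum_add {ι : Type*} (s : Finset ι) {φ ψ : ι → ℝ → ℂ}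
    (hφ : ∀ i ∈ s, HasRLDifferintegral α (φ i) (ψ i)) (h : HasRLDifferintegral α f g) :
    HasRLDifferintegral α (fun x => ∑ i ∈ s, φ i x + f x) fun x => ∑ i ∈ s, ψ i x + g x := by
  classical
  induction s using Finset.induction_on with
  | empty => simpa using h
  | insert i s hi ih =>
    simpa only [Finset.sum_insert hi, add_assoc] using
      (hφ i (Finset.mem_insert_self i s)).add (ih fun j hj => hφ j (Finset.mem_insert_of_mem hj))

end Linearity

theorem derivOrder_neg_add_pos {α : ℝ} : 0 < (derivOrder (-α) + α : ℝ) := by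
  rw [derivOrder, Nat.cast_add_one]
  linarith [Nat.lt_floor_add_one (-α)]

theorem iteratedDeriv_rlPower (m : ℕ) (a z : ℂ) :
    Set.EqOn (iteratedDeriv m (rlPower (a + m) z)) (rlPower a z) (Set.Ioi 0) := by
  induction m generalizing a with
  | zero => simp [Set.EqOn]
  | succ m ih =>
    intro x hx
    have hev : iteratedDeriv m (rlPower (a + (m + 1 : ℕ)) z) =ᶠ[𝓝 x] rlPower (a + 1) z := by
      rw [Nat.cast_succ, add_comm (m : ℂ), ← add_assoc]
      exact (ih (a + 1)).eventuallyEq_of_mem (Ioi_mem_nhds hx)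
    rw [iteratedDeriv_succ, hev.deriv_eq, (hasDerivAt_rlPower a z (ne_of_gt hx)).deriv]

theorem hasRLDifferintegral_cpow (α : ℝ) {z : ℂ} (hz : ∀ k : ℕ, z ≠ -(k : ℂ)) :
    HasRLDifferintegral α (fun x => (x : ℂ) ^ (z - 1)) (rlPower α z) where
  of_pos hα _ hx := hasFPIntegral_rpow_sub_mul_cpow hα hx hz
  of_zero hα x _ := by
    rw [rlPower, hα, Complex.ofReal_zero, add_zero, div_self (Complex.Gamma_ne_zero hz), one_mul]
  of_neg _ := by
    refine ⟨rlPower (α + derivOrder (-α)) z, fun x hx => ?_,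
      contDiffOn_const.mul (contDiffOn_ofReal_cpow _ _), iteratedDeriv_rlPower _ _ _⟩
    convert hasFPIntegral_rpow_sub_mul_cpow derivOrder_neg_add_pos hx hz using 3
    push_cast
    ring

section Smooth

variable {α ν : ℝ} {F : ℝ → ℂ} {k : ℕ}

theorem hasRLIntegral_of_continuous (hν : 0 < ν) (hF : Continuous F) :
    HasRLIntegral ν F (rlIntegral ν F) := fun x hx => by
  have hΓ : (Real.Gamma ν : ℂ) ≠ 0 := Complex.ofReal_ne_zero.2 (Real.Gamma_pos_of_pos hν).ne'
  convert hasFPIntegral_of_intervalIntegrable hx (intervalIntegrable_rpow_sub_mul hν hF 0 x x)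
    using 1
  rw [rlIntegral, Complex.ofReal_div, Complex.ofReal_one, ← mul_assoc, mul_one_div_cancel hΓ,
    one_mul]

theorem hasRLDifferintegral_of_contDiff (hk : derivOrder (-α) ≤ k) (hF : ContDiff ℝ k F)
    (h0 : ∀ x ≤ 0, F x = 0) :
    HasRLDifferintegral α F (rlIntegral (α + k) (iteratedDeriv k F)) where
  of_pos hα x hx := by
    rw [← rlIntegral_eq_rlIntegral_iteratedDeriv hα hF h0 hx.le]
    exact hasRLIntegral_of_continuous hα hF.continuous x hx
  of_zero hα x hx := by
    have hk0 : k ≠ 0 := by rw [derivOrder] at hk; omega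
    rw [hα, zero_add, eq_rlIntegral_iteratedDeriv hk0 hF h0 (le_of_lt hx)]
  of_neg _ := by
    set m := derivOrder (-α)
    have hν : 0 < (m + α : ℝ) := derivOrder_neg_add_pos
    have hFm : ContDiff ℝ m F := hF.of_le (by exact_mod_cast hk)
    refine ⟨rlIntegral (m + α) F, hasRLIntegral_of_continuous hν hF.continuous,
      (contDiff_rlIntegral hν hFm h0).contDiffOn, fun x hx => ?_⟩
    obtain ⟨l, rfl⟩ := Nat.exists_eq_add_of_le' hk
    have hl : ContDiff ℝ l (iteratedDeriv m F) := by
      rw [iteratedDeriv_eq_iterate]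
      exact hF.iterate_deriv' l m
    rw [iteratedDeriv_rlIntegral hν hFm h0, rlIntegral_eq_rlIntegral_iteratedDeriv hν hl
      (iteratedDeriv_eq_zero_of_nonpos hFm h0) (le_of_lt hx)]
    simp only [iteratedDeriv_eq_iterate, ← Function.iterate_add_apply]
    congr 1
    push_cast
    ring

end Smooth

/-! ### The substantial operators as conjugates of the Riemann–Liouville operators -/

theorem contDiff_ofReal_exp_mul (σ : ℝ) {n : WithTop ℕ∞} :
    ContDiff ℝ n (fun x : ℝ => (Real.exp (σ * x) : ℂ)) :=
  Complex.ofRealCLM.contDiff.comp (Real.contDiff_exp.comp (contDiff_const.mul contDiff_id))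

theorem iterate_substD_eq_exp_mul_iteratedDeriv {σ : ℝ} {m : ℕ} {u v : ℝ → ℂ}
    (hu : ContDiffOn ℝ m u (Set.Ioi 0))
    (hv : Set.EqOn v (fun x => (Real.exp (-σ * x) : ℂ) * u x) (Set.Ioi 0)) :
    Set.EqOn ((substD σ)^[m] v) (fun x => (Real.exp (-σ * x) : ℂ) * iteratedDeriv m u x)
      (Set.Ioi 0) := by
  induction m generalizing u v with
  | zero => simpa using hv
  | succ m ih =>
    rw [Function.iterate_succ_apply, iteratedDeriv_succ']
    refine ih (hu.deriv_of_isOpen isOpen_Ioi (by norm_cast)) fun x hx => ?_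
    have hexp : HasDerivAt (fun x : ℝ => (Real.exp (-σ * x) : ℂ))
        ((Real.exp (-σ * x) * (-σ * 1) : ℝ) : ℂ) x :=
      (((hasDerivAt_id x).const_mul (-σ)).exp).ofReal_comp
    have hux : DifferentiableAt ℝ u x :=
      (hu.differentiableOn (by simp)).differentiableAt (Ioi_mem_nhds hx)
    rw [substD, hv hx, (hv.eventuallyEq_of_mem (Ioi_mem_nhds hx)).deriv_eq,
      (hexp.fun_mul hux.hasDerivAt).deriv]
    push_cast
    ring

section ExpMul

variable {α ν : ℝ} {f g u : ℝ → ℂ}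

theorem HasRLIntegral.hasFPIntegral_substKernel (σ : ℝ) (h : HasRLIntegral ν f u) {x : ℝ}
    (hx : 0 < x) : HasFPIntegral (substKernel σ ν (fun x => (Real.exp (-σ * x) : ℂ) * f x) x) x
      (Real.Gamma ν * ((Real.exp (-σ * x) : ℂ) * u x)) := by
  rw [mul_left_comm]
  refine ((h x hx).const_mul (Real.exp (-σ * x) : ℂ)).congr hx fun τ _ => ?_
  have hexp : Real.exp (-σ * x) = Real.exp (-σ * (x - τ)) * Real.exp (-σ * τ) := by
    rw [← Real.exp_add]
    congr 1
    ring
  rw [substKernel, hexp]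
  push_cast
  ring

theorem HasRLIntegral.substIntegral_exp_mul (σ : ℝ) (h : HasRLIntegral ν f u) (hν : 0 < ν) :
    Set.EqOn (substIntegral σ ν fun x => (Real.exp (-σ * x) : ℂ) * f x)
      (fun x => (Real.exp (-σ * x) : ℂ) * u x) (Set.Ioi 0) := fun x hx => by
  have hΓ : (Real.Gamma ν : ℂ) ≠ 0 := Complex.ofReal_ne_zero.2 (Real.Gamma_pos_of_pos hν).ne'
  rw [substIntegral, (h.hasFPIntegral_substKernel σ hx).fpIntegral_eq, Complex.ofReal_div,
    Complex.ofReal_one, ← mul_assoc, one_div_mul_cancel hΓ, one_mul]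

theorem HasRLDifferintegral.substOpExists_exp_mul (σ : ℝ) (h : HasRLDifferintegral α f g) :
    SubstOpExists σ α fun x => (Real.exp (-σ * x) : ℂ) * f x := by
  refine ⟨fun hα x hx => ⟨_, (h.of_pos hα).hasFPIntegral_substKernel σ hx⟩, fun hα => ?_⟩
  obtain ⟨u, hu, hud, -⟩ := h.of_neg hα
  rw [sub_neg_eq_add]
  exact ⟨fun x hx => ⟨_, hu.hasFPIntegral_substKernel σ hx⟩,
    ((contDiff_ofReal_exp_mul (-σ)).contDiffOn.mul hud).congr
      (hu.substIntegral_exp_mul σ derivOrder_neg_add_pos)⟩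

theorem HasRLDifferintegral.substOp_exp_mul (σ : ℝ) (h : HasRLDifferintegral α f g) :
    Set.EqOn (substOp σ α fun x => (Real.exp (-σ * x) : ℂ) * f x)
      (fun x => (Real.exp (-σ * x) : ℂ) * g x) (Set.Ioi 0) := by
  rcases lt_trichotomy α 0 with hα | hα | hα
  · obtain ⟨u, hu, hud, hug⟩ := h.of_neg hα
    intro x hx
    rw [substOp, if_neg hα.not_gt, if_neg hα.ne, substDeriv, sub_neg_eq_add,
      iterate_substD_eq_exp_mul_iteratedDeriv hud
        (hu.substIntegral_exp_mul σ derivOrder_neg_add_pos) hx]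
    exact congrArg _ (hug hx)
  · intro x hx
    simp only [substOp, hα, lt_irrefl, if_false, if_true, h.of_zero hα hx]
  · rw [substOp, if_pos hα]
    exact (h.of_pos hα).substIntegral_exp_mul σ hα

end ExpMul

/-! ### Remainders of Taylor expansions at the origin -/

/-- `R` is `N` times continuously differentiable on `[0, ∞)`, and its derivatives of order less than
`N` vanish at `0`. -/
def VanishesToOrder : ℕ → (ℝ → ℂ) → Prop
  | 0, R => ContinuousOn R (Set.Ici 0)
  | N + 1, R => R 0 = 0 ∧ ∃ R' : ℝ → ℂ,
      (∀ x ∈ Set.Ici (0 : ℝ), HasDerivWithinAt R (R' x) (Set.Ici 0) x) ∧ VanishesToOrder N R'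

theorem VanishesToOrder.continuousOn {N : ℕ} {R : ℝ → ℂ} (h : VanishesToOrder N R) :
    ContinuousOn R (Set.Ici 0) := by
  cases N with
  | zero => exact h
  | succ N =>
    obtain ⟨_, R', hR', _⟩ := h
    exact fun x hx => (hR' x hx).continuousWithinAt

theorem VanishesToOrder.const_mul {N : ℕ} {R : ℝ → ℂ} (h : VanishesToOrder N R) (a : ℂ) :
    VanishesToOrder N fun x => a * R x := by
  induction N generalizing R with
  | zero => exact continuousOn_const.mul h
  | succ N ih =>
    obtain ⟨h0, R', hR', hV⟩ := h
    exact ⟨by simp [h0], _, fun x hx => (hR' x hx).const_mul a, ih hV⟩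

theorem exists_vanishesToOrder_sub {N : ℕ} {g : ℝ → ℂ} (hg : ContDiffOn ℝ N g (Set.Ici 0)) :
    ∃ c : ℕ → ℂ, VanishesToOrder N fun x => g x - ∑ q ∈ Finset.range N, c q * (x : ℂ) ^ q := by
  induction N generalizing g with
  | zero => exact ⟨0, by simpa [VanishesToOrder] using hg.continuousOn⟩
  | succ N ih =>
    obtain ⟨hdiff, -, hderiv⟩ := (contDiffOn_succ_iff_derivWithin (n := (N : ℕ))
      (uniqueDiffOn_Ici 0)).1 (by exact_mod_cast hg)
    obtain ⟨c, hc⟩ := ih hderiv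
    refine ⟨fun q => Nat.casesOn q (g 0) fun q => c q / (q + 1), ?_, _, fun x hx => ?_, hc⟩
    · simp [Finset.sum_range_succ']
    · refine (hdiff x hx).hasDerivWithinAt.sub ?_
      simp only [Finset.sum_range_succ', pow_zero, mul_one]
      refine HasDerivWithinAt.congr_deriv (HasDerivWithinAt.add (HasDerivWithinAt.fun_sum fun q _ =>
        HasDerivAt.hasDerivWithinAt
          ((((hasDerivAt_id (x : ℂ)).pow (q + 1)).comp_ofReal).const_mul _))
        (hasDerivWithinAt_const _ _ _)) ?_
      rw [add_zero]
      refine Finset.sum_congr rfl fun q _ => ?_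
      have : (q : ℂ) + 1 ≠ 0 := by exact_mod_cast q.succ_ne_zero
      simp only [Nat.cast_add, Nat.cast_one, id_eq, add_tsub_cancel_right, mul_one]
      field_simp

theorem VanishesToOrder.exists_norm_le_mul_pow {N : ℕ} {R : ℝ → ℂ} (h : VanishesToOrder N R)
    (b : ℝ) : ∃ C, 0 ≤ C ∧ ∀ x ∈ Set.Icc 0 b, ‖R x‖ ≤ C * x ^ N := by
  induction N generalizing R with
  | zero =>
    obtain ⟨C, hC⟩ := (isCompact_Icc (a := 0) (b := b)).exists_bound_of_continuousOn
      (ContinuousOn.mono h fun x hx => hx.1)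
    exact ⟨max C 0, le_max_right _ _, fun x hx => by simpa using Or.inl (hC x hx)⟩
  | succ N ih =>
    obtain ⟨h0, R', hR', hV⟩ := h
    obtain ⟨C, hC0, hC⟩ := ih hV
    refine ⟨C, hC0, fun x hx => ?_⟩
    have hmvt := Convex.norm_image_sub_le_of_norm_hasDerivWithin_le (f := R) (f' := R')
      (s := Set.Icc 0 x) (C := C * x ^ N) (x := 0) (y := x)
      (fun y hy => (hR' y hy.1).mono fun t ht => ht.1)
      (fun y hy => (hC y ⟨hy.1, hy.2.trans hx.2⟩).trans
        (mul_le_mul_of_nonneg_left (pow_le_pow_left₀ hy.1 hy.2 _) hC0))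
      (convex_Icc 0 x) (Set.left_mem_Icc.2 hx.1) (Set.right_mem_Icc.2 hx.1)
    rw [h0, sub_zero, sub_zero, Real.norm_of_nonneg hx.1] at hmvt
    rwa [pow_succ, ← mul_assoc]

/-- The function `x ^ γ * R x` on `(0, ∞)`, extended by zero to the whole line. -/
noncomputable def cpowMulPos (γ : ℂ) (R : ℝ → ℂ) (x : ℝ) : ℂ :=
  if x ≤ 0 then 0 else (x : ℂ) ^ γ * R x

theorem cpowMulPos_of_nonpos {γ : ℂ} {R : ℝ → ℂ} {x : ℝ} (hx : x ≤ 0) : cpowMulPos γ R x = 0 :=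
  if_pos hx

theorem cpowMulPos_of_pos {γ : ℂ} {R : ℝ → ℂ} {x : ℝ} (hx : 0 < x) :
    cpowMulPos γ R x = (x : ℂ) ^ γ * R x :=
  if_neg hx.not_ge

theorem exists_norm_cpowMulPos_le {N : ℕ} {R : ℝ → ℂ} (h : VanishesToOrder N R) (γ : ℂ) (b : ℝ) :
    ∃ C, ∀ x ≤ b, ‖cpowMulPos γ R x‖ ≤ C * |x| ^ (γ.re + N) := by
  obtain ⟨C, hC0, hC⟩ := h.exists_norm_le_mul_pow b
  refine ⟨C, fun x hx => ?_⟩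
  rcases le_or_gt x 0 with h0 | h0
  · rw [cpowMulPos_of_nonpos h0, norm_zero]
    positivity
  · rw [cpowMulPos_of_pos h0, norm_mul, Complex.norm_cpow_eq_rpow_re_of_pos h0, abs_of_pos h0,
      Real.rpow_add h0, Real.rpow_natCast, mul_left_comm]
    exact mul_le_mul_of_nonneg_left (hC x ⟨h0.le, hx⟩) (by positivity)

theorem continuous_cpowMulPos {N : ℕ} {R : ℝ → ℂ} (h : VanishesToOrder N R) {γ : ℂ}
    (hγ : 0 < γ.re + N) : Continuous (cpowMulPos γ R) := by
  refine continuous_iff_continuousAt.2 fun x => ?_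
  rcases lt_trichotomy x 0 with hx | rfl | hx
  · refine continuousAt_const.congr (f := fun _ => 0) ?_
    filter_upwards [Iio_mem_nhds hx] with y hy using (cpowMulPos_of_nonpos (le_of_lt hy)).symm
  · obtain ⟨C, hC⟩ := exists_norm_cpowMulPos_le h γ 1
    rw [ContinuousAt, cpowMulPos_of_nonpos le_rfl]
    refine squeeze_zero_norm' (a := fun x : ℝ => C * |x| ^ (γ.re + N)) ?_ ?_
    · filter_upwards [Iic_mem_nhds (zero_lt_one (α := ℝ))] with y hy using hC y hy
    · have hcont : ContinuousAt (fun x : ℝ => C * |x| ^ (γ.re + N)) 0 :=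
        continuousAt_const.mul (continuous_abs.continuousAt.rpow_const (Or.inr hγ.le))
      simpa [Real.zero_rpow hγ.ne'] using hcont.tendsto
  · have hR : ContinuousAt R x := h.continuousOn.continuousAt (Ici_mem_nhds hx)
    refine ((Complex.continuousAt_ofReal_cpow_const x γ (Or.inr hx.ne')).mul hR).congr ?_
    filter_upwards [Ioi_mem_nhds hx] with y hy using (cpowMulPos_of_pos hy).symm

theorem hasDerivAt_cpowMulPos_zero {N : ℕ} {R : ℝ → ℂ} (h : VanishesToOrder N R) {γ : ℂ}
    (hγ : 1 < γ.re + N) : HasDerivAt (cpowMulPos γ R) 0 0 := by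
  obtain ⟨C, hC⟩ := exists_norm_cpowMulPos_le h γ 1
  have hbound : cpowMulPos γ R =O[𝓝 0] fun x : ℝ => |x| ^ (γ.re + N - 1) * x := by
    refine Asymptotics.IsBigO.of_bound C ?_
    filter_upwards [Iic_mem_nhds (zero_lt_one (α := ℝ))] with y hy
    refine (hC y hy).trans_eq ?_
    rw [norm_mul, Real.norm_of_nonneg (by positivity), Real.norm_eq_abs,
      ← Real.rpow_add_one' (abs_nonneg y) (by linarith), sub_add_cancel]
  have hsmall : (fun x : ℝ => |x| ^ (γ.re + N - 1)) =o[𝓝 0] fun _ => (1 : ℝ) := by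
    have hcont : ContinuousAt (fun x : ℝ => |x| ^ (γ.re + N - 1)) 0 :=
      continuous_abs.continuousAt.rpow_const (Or.inr (by linarith))
    simpa [Asymptotics.isLittleO_one_iff, ContinuousAt, Real.zero_rpow (sub_pos.2 hγ).ne']
      using hcont
  rw [hasDerivAt_iff_isLittleO_nhds_zero]
  simp only [zero_add, cpowMulPos_of_nonpos le_rfl, sub_zero, smul_zero]
  simpa only [one_mul] using
    hbound.trans_isLittleO (hsmall.mul_isBigO (Asymptotics.isBigO_refl (fun x : ℝ => x) (𝓝 0)))

theorem hasDerivAt_cpowMulPos {N : ℕ} {R R' : ℝ → ℂ} (h : VanishesToOrder N R)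
    (hR' : ∀ x ∈ Set.Ici (0 : ℝ), HasDerivWithinAt R (R' x) (Set.Ici 0) x) {γ : ℂ}
    (hγ : 1 < γ.re + N) (x : ℝ) :
    HasDerivAt (cpowMulPos γ R)
      (cpowMulPos (γ - 1) (fun y => γ * R y) x + cpowMulPos γ R' x) x := by
  rcases lt_trichotomy x 0 with hx | rfl | hx
  · rw [cpowMulPos_of_nonpos hx.le, cpowMulPos_of_nonpos hx.le, add_zero]
    refine (hasDerivAt_const x (0 : ℂ)).congr_of_eventuallyEq ?_
    filter_upwards [Iio_mem_nhds hx] with y hy using cpowMulPos_of_nonpos (le_of_lt hy)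
  · rw [cpowMulPos_of_nonpos le_rfl, cpowMulPos_of_nonpos le_rfl, add_zero]
    exact hasDerivAt_cpowMulPos_zero h hγ
  · have hR : HasDerivAt R (R' x) x := (hR' x hx.le).hasDerivAt (Ici_mem_nhds hx)
    have hprod := (hasDerivAt_ofReal_cpow_of_ne_zero hx.ne' γ).mul hR
    rw [cpowMulPos_of_pos hx, cpowMulPos_of_pos hx]
    refine (hprod.congr_of_eventuallyEq ?_).congr_deriv (by ring)
    filter_upwards [Ioi_mem_nhds hx] with y hy using cpowMulPos_of_pos hy

theorem contDiff_cpowMulPos {k N : ℕ} (hkN : k ≤ N) {R : ℝ → ℂ} (h : VanishesToOrder N R) {γ : ℂ}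
    (hγ : k < γ.re + N) : ContDiff ℝ k (cpowMulPos γ R) := by
  induction k generalizing N R γ with
  | zero => exact contDiff_zero.2 (continuous_cpowMulPos h (by simpa using hγ))
  | succ k ih =>
    obtain ⟨N, rfl⟩ := Nat.exists_eq_add_of_le' (Nat.one_le_of_lt hkN)
    obtain ⟨-, R', hR', hV⟩ := id h
    push_cast at hγ
    have hderiv := hasDerivAt_cpowMulPos h hR' (γ := γ) (by
      push_cast
      linarith [k.cast_nonneg (α := ℝ)])
    push_cast
    refine contDiff_succ_iff_deriv.2
      ⟨fun x => (hderiv x).differentiableAt, fun h => absurd h (by simp), ?_⟩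
    rw [funext fun x => (hderiv x).deriv]
    refine (ih (by omega) (h.const_mul γ) ?_).add (ih (by omega) hV ?_)
    · rw [Complex.sub_re, Complex.one_re]; push_cast; linarith
    · linarith

theorem zero_cpow_eq_zero_of_ne_neg_nat {β : ℂ} (hβ : ∀ k : ℕ, β ≠ -(k : ℂ)) (hβ1 : β ≠ 1)
    (q : ℕ) : (0 : ℂ) ^ ((q : ℂ) + β - 1) = 0 := by
  refine Complex.zero_cpow ?_
  rcases q with _ | q
  · simpa [sub_eq_zero] using hβ1
  · intro e
    push_cast at e
    exact hβ q (by linear_combination e)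

theorem exists_cpow_mul_eq_sum_add_cpowMulPos {β : ℂ} (hβ : ∀ k : ℕ, β ≠ -(k : ℂ)) {r : ℕ}
    (hr : r ≠ 0) {g : ℝ → ℂ} (hg : ContDiffOn ℝ r g (Set.Ici 0)) :
    ∃ (c : ℕ → ℂ) (R : ℝ → ℂ), VanishesToOrder r R ∧ ∀ x : ℝ, 0 ≤ x →
      (x : ℂ) ^ (β - 1) * g x =
        ∑ q ∈ Finset.range r, c q * (x : ℂ) ^ ((q : ℂ) + β - 1) + cpowMulPos (β - 1) R x := by
  obtain ⟨c, hR⟩ := exists_vanishesToOrder_sub hg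
  refine ⟨c, _, hR, fun x hx => ?_⟩
  rcases hx.eq_or_lt with rfl | hx
  · rw [cpowMulPos_of_nonpos le_rfl, add_zero, Complex.ofReal_zero]
    rcases eq_or_ne β 1 with rfl | hβ1
    · obtain ⟨r, rfl⟩ := Nat.exists_eq_succ_of_ne_zero hr
      simpa using sub_eq_zero.1 hR.1
    · simp only [zero_cpow_eq_zero_of_ne_neg_nat hβ hβ1, mul_zero, Finset.sum_const_zero,
        Complex.zero_cpow (sub_ne_zero.2 hβ1), zero_mul]
  · have hpow (q : ℕ) : (x : ℂ) ^ ((q : ℂ) + β - 1) = (x : ℂ) ^ (β - 1) * (x : ℂ) ^ q := by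
      rw [add_sub_assoc, Complex.cpow_add _ _ (by exact_mod_cast hx.ne'), Complex.cpow_natCast,
        mul_comm]
    simp only [cpowMulPos_of_pos hx, hpow, mul_sub, Finset.mul_sum, mul_left_comm (c _),
      add_sub_cancel]

/-! ### Quadrature errors for powers -/

theorem convQuad_zero (α : ℝ) (ω : ℕ → ℂ) (h : ℝ) (n : ℕ) (u : ℝ → ℂ) :
    convQuad 0 α ω h n u =
      ((h ^ α : ℝ) : ℂ) * ∑ j ∈ Finset.range (n + 1), ω (n - j) * u (j * h) := by
  simp [convQuad, convWeight]

theorem convWeight_mul_exp (σ : ℝ) (ω : ℕ → ℂ) (h : ℝ) {n j : ℕ} (hj : j ≤ n) :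
    convWeight σ ω h (n - j) * (Real.exp (-σ * (j * h)) : ℂ) =
      (Real.exp (-σ * (n * h)) : ℂ) * ω (n - j) := by
  rw [convWeight, mul_right_comm, ← Complex.ofReal_mul, ← Real.exp_add, Nat.cast_sub hj]
  ring_nf

theorem convQuad_exp_mul (σ α : ℝ) (ω : ℕ → ℂ) (h : ℝ) (n : ℕ) (u : ℝ → ℂ) :
    convQuad σ α ω h n (fun x => (Real.exp (-σ * x) : ℂ) * u x) =
      (Real.exp (-σ * (n * h)) : ℂ) * convQuad 0 α ω h n u := by
  rw [convQuad_zero, convQuad, mul_left_comm, Finset.mul_sum _ _ (Real.exp _ : ℂ)]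
  congr 1
  refine Finset.sum_congr rfl fun j hj => ?_
  rw [← mul_assoc, convWeight_mul_exp σ ω h (Nat.lt_succ_iff.1 (Finset.mem_range.1 hj)), mul_assoc]

/-- The error at `n` of the untwisted quadrature with step size `1` for the power `x ^ (z - 1)`. -/
noncomputable def powerError (α : ℝ) (ω : ℕ → ℂ) (z : ℂ) (n : ℕ) : ℂ :=
  ∑ j ∈ Finset.range (n + 1), ω (n - j) * (j : ℂ) ^ (z - 1) - rlPower α z n

theorem rpow_mul_cpow_mul {h : ℝ} (hh : 0 < h) (α : ℝ) (z : ℂ) (j : ℕ) :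
    ((h ^ α : ℝ) : ℂ) * ((j * h : ℝ) : ℂ) ^ (z - 1) =
      (h : ℂ) ^ (z + α - 1) * (j : ℂ) ^ (z - 1) := by
  rw [Complex.ofReal_mul, Complex.mul_cpow_ofReal_nonneg j.cast_nonneg hh.le,
    Complex.ofReal_cpow hh.le, add_sub_right_comm,
    Complex.cpow_add _ _ (by exact_mod_cast hh.ne'), Complex.ofReal_natCast]
  ring

theorem convQuad_cpow_sub_rlPower {h : ℝ} (hh : 0 < h) (α : ℝ) (ω : ℕ → ℂ) (z : ℂ) (n : ℕ) :
    convQuad 0 α ω h n (fun x => (x : ℂ) ^ (z - 1)) - rlPower α z (n * h) =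
      (h : ℂ) ^ (z + α - 1) * powerError α ω z n := by
  rw [convQuad_zero, powerError, rlPower_mul _ _ n.cast_nonneg hh.le, mul_sub, Finset.mul_sum,
    Finset.mul_sum]
  simp only [mul_left_comm _ (ω _), rpow_mul_cpow_mul hh]

theorem quadError_cpow {z : ℂ} (hz : ∀ k : ℕ, z ≠ -(k : ℂ)) (σ α : ℝ) (ω : ℕ → ℂ) {h : ℝ}
    (hh : 0 < h) {n : ℕ} (hn : 1 ≤ n) :
    quadError σ α ω h n (fun t => (Real.exp (-σ * t) : ℂ) * (t : ℂ) ^ (z - 1)) =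
      (Real.exp (-σ * (n * h)) : ℂ) * ((h : ℂ) ^ (z + α - 1) * powerError α ω z n) := by
  have hnh : n * h ∈ Set.Ioi (0 : ℝ) := mul_pos (by exact_mod_cast hn) hh
  rw [quadError, convQuad_exp_mul, (hasRLDifferintegral_cpow α hz).substOp_exp_mul σ hnh,
    ← mul_sub, convQuad_cpow_sub_rlPower hh]

theorem IsConvergentOfOrder.powerError_isBigO {σ α : ℝ} {ω : ℕ → ℂ} {p : ℕ}
    (hω : IsConvergentOfOrder σ α ω p) {z : ℂ} (hz : ∀ k : ℕ, z ≠ -(k : ℂ)) :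
    powerError α ω z =O[𝓟 (Set.Ici 1)]
      fun n : ℕ => (n : ℝ) ^ (α - 1) + (n : ℝ) ^ (α + z.re - 1 - p) := by
  obtain ⟨C, -, hC⟩ := Asymptotics.bound_of_isBigO_nat_atTop (hω z hz)
  refine Asymptotics.isBigO_principal.2 ⟨Real.exp σ * C, fun n hn => ?_⟩
  have hn0 : (0 : ℝ) < n := by exact_mod_cast Nat.lt_of_succ_le hn
  have hpow : ∀ e : ℝ, (1 / (n : ℝ)) ^ e = (n : ℝ) ^ (-e) := fun e => by
    rw [one_div, Real.inv_rpow hn0.le, Real.rpow_neg hn0.le]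
  have hre : (z + (α : ℂ) - 1).re = z.re + α - 1 := by simp
  have hbound := hC (x := n) (by positivity)
  rw [quadError_cpow hz σ α ω (one_div_pos.2 hn0) hn, mul_one_div_cancel hn0.ne', mul_one, norm_mul,
    norm_mul, Complex.norm_real, Real.norm_of_nonneg (Real.exp_pos _).le,
    Complex.norm_cpow_eq_rpow_re_of_pos (one_div_pos.2 hn0), Real.norm_of_nonneg (by positivity),
    ← Real.rpow_natCast, hpow, hpow, hpow, hre] at hbound
  rw [Real.norm_of_nonneg (by positivity)]
  calc ‖powerError α ω z n‖
    _ = Real.exp σ * (n : ℝ) ^ (z.re + α - 1) *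
        (Real.exp (-σ) * ((n : ℝ) ^ (-(z.re + α - 1)) * ‖powerError α ω z n‖)) := by
      rw [Real.exp_neg, Real.rpow_neg hn0.le]
      field_simp
    _ ≤ Real.exp σ * (n : ℝ) ^ (z.re + α - 1) *
        (C * ((n : ℝ) ^ (-z.re) + (n : ℝ) ^ (-(p : ℝ)))) := by gcongr
    _ = Real.exp σ * C * ((n : ℝ) ^ (α - 1) + (n : ℝ) ^ (α + z.re - 1 - p)) := by
      rw [show α - 1 = (z.re + α - 1) + -z.re by ring,
        show α + z.re - 1 - p = (z.re + α - 1) + -(p : ℝ) by ring, Real.rpow_add hn0,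
        Real.rpow_add hn0]
      ring

/-! ### Quadrature errors for shifted powers -/

theorem isBigO_prod_Icc_of_hasDerivAt {ι E : Type*} [NormedAddCommGroup E] [NormedSpace ℝ E]
    {s : Set ι} {φ φ' : ι → ℝ → E} {b : ι → ℝ}
    (hφ : ∀ i ∈ s, ∀ t ∈ Set.Icc (0 : ℝ) 1, HasDerivAt (φ i) (φ' i t) t)
    (h0 : (fun i => φ i 0) =O[𝓟 s] b)
    (h' : (fun q : ι × ℝ => φ' q.1 q.2) =O[𝓟 (s ×ˢ Set.Icc 0 1)] fun q => b q.1) :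
    (fun q : ι × ℝ => φ q.1 q.2) =O[𝓟 (s ×ˢ Set.Icc 0 1)] fun q => b q.1 := by
  obtain ⟨A, hA⟩ := Asymptotics.isBigO_principal.1 h0
  obtain ⟨B, hB⟩ := Asymptotics.isBigO_principal.1 h'
  refine Asymptotics.isBigO_principal.2 ⟨A + B, fun ⟨i, t⟩ ⟨hi, ht⟩ => ?_⟩
  have hmvt := Convex.norm_image_sub_le_of_norm_hasDerivWithin_le
    (f' := φ' i) (C := B * ‖b i‖) (fun y hy => (hφ i hi y hy).hasDerivWithinAt)
    (fun y hy => hB (i, y) ⟨hi, hy⟩)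
    (convex_Icc 0 1) (Set.left_mem_Icc.2 zero_le_one) ht
  rw [sub_zero, Real.norm_of_nonneg ht.1] at hmvt
  have hB0 : 0 ≤ B * ‖b i‖ := (norm_nonneg _).trans (hB (i, t) ⟨hi, ht⟩)
  calc ‖φ i t‖ ≤ ‖φ i 0‖ + ‖φ i t - φ i 0‖ := norm_le_norm_add_norm_sub' _ _
    _ ≤ A * ‖b i‖ + B * ‖b i‖ :=
      add_le_add (hA i hi) (hmvt.trans (mul_le_of_le_one_right hB0 ht.2))
    _ = (A + B) * ‖b i‖ := (add_mul _ _ _).symm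

/-- The error at `n` of the untwisted quadrature with step size `1` for the shifted power
`(x + θ) ^ K / K!`, whose Riemann–Liouville integral is taken from the zero `-θ` of that power. -/
noncomputable def shiftedError (α : ℝ) (ω : ℕ → ℂ) (K n : ℕ) (θ : ℝ) : ℂ :=
  ∑ j ∈ Finset.range (n + 1), ω (n - j) * (((j + θ) ^ K / K.factorial : ℝ) : ℂ) -
    rlPower (α + K) 1 (n + θ)

theorem shiftedError_zero (α : ℝ) (ω : ℕ → ℂ) (K n : ℕ) :
    shiftedError α ω K n 0 = (K.factorial : ℂ)⁻¹ * powerError α ω (K + 1) n := by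
  have hK : (K.factorial : ℂ) ≠ 0 := by exact_mod_cast K.factorial_ne_zero
  rw [shiftedError, powerError, mul_sub, Finset.mul_sum, rlPower, rlPower,
    Complex.Gamma_nat_eq_factorial, Complex.Gamma_one]
  congr 1
  · refine Finset.sum_congr rfl fun j _ => ?_
    rw [add_zero, add_sub_cancel_right, Complex.cpow_natCast]
    push_cast
    ring
  · rw [add_zero, show (1 : ℂ) + (α + K) = K + 1 + α by ring]
    field_simp

theorem hasDerivAt_rlPower_add (a z : ℂ) {n : ℕ} (hn : 1 ≤ n) {θ : ℝ} (hθ : 0 ≤ θ) :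
    HasDerivAt (fun θ : ℝ => rlPower (a + 1) z (n + θ)) (rlPower a z (n + θ)) θ :=
  (hasDerivAt_rlPower a z (add_pos_of_pos_of_nonneg (by exact_mod_cast hn) hθ).ne').comp_const_add
    (n : ℝ) θ

theorem hasDerivAt_shiftedError_zero (α : ℝ) (ω : ℕ → ℂ) {n : ℕ} (hn : 1 ≤ n) {θ : ℝ}
    (hθ : 0 ≤ θ) : HasDerivAt (shiftedError α ω 0 n) (-rlPower (α - 1) 1 (n + θ)) θ := by
  have hpow := hasDerivAt_rlPower_add (α - 1) 1 hn hθ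
  rw [sub_add_cancel] at hpow
  refine (hpow.const_sub (∑ j ∈ Finset.range (n + 1), ω (n - j))).congr_of_eventuallyEq
    (Eventually.of_forall fun t => ?_)
  simp [shiftedError]

theorem hasDerivAt_shiftedError_succ (α : ℝ) (ω : ℕ → ℂ) (K : ℕ) {n : ℕ} (hn : 1 ≤ n) {θ : ℝ}
    (hθ : 0 ≤ θ) : HasDerivAt (shiftedError α ω (K + 1) n) (shiftedError α ω K n θ) θ := by
  have hpow := hasDerivAt_rlPower_add (α + K) 1 hn hθ
  rw [add_assoc, ← Nat.cast_add_one] at hpow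
  refine (HasDerivAt.fun_sum fun j _ => ?_).sub hpow
  have hterm := (((((hasDerivAt_id θ).const_add (j : ℝ)).pow (K + 1)).div_const
    ((K + 1).factorial : ℝ)).ofReal_comp).const_mul (ω (n - j))
  refine hterm.congr_deriv ?_
  have hK : (K.factorial : ℝ) ≠ 0 := by exact_mod_cast K.factorial_ne_zero
  congr 2
  simp only [Nat.factorial_succ, id, Nat.cast_mul, Nat.cast_succ, Nat.add_sub_cancel]
  field_simp

theorem add_rpow_le {n : ℕ} (hn : 1 ≤ n) {θ : ℝ} (hθ : θ ∈ Set.Icc (0 : ℝ) 1) (a : ℝ) :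
    ((n : ℝ) + θ) ^ a ≤ 2 ^ |a| * (n : ℝ) ^ a := by
  have hn1 : (1 : ℝ) ≤ n := by exact_mod_cast hn
  have hn0 : (0 : ℝ) < n := by linarith
  have hratio : θ / n ∈ Set.Icc (0 : ℝ) 1 :=
    ⟨div_nonneg hθ.1 hn0.le, (div_le_one hn0).2 (hθ.2.trans hn1)⟩
  rw [show (n : ℝ) + θ = (1 + θ / n) * n by field_simp,
    Real.mul_rpow (by linarith [hratio.1]) hn0.le]
  gcongr
  calc (1 + θ / n) ^ a ≤ (1 + θ / n) ^ |a| :=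
        Real.rpow_le_rpow_of_exponent_le (by linarith [hratio.1]) (le_abs_self a)
    _ ≤ 2 ^ |a| :=
        Real.rpow_le_rpow (by linarith [hratio.1]) (by linarith [hratio.2]) (abs_nonneg a)

theorem rlPower_add_isBigO (a z : ℂ) :
    (fun q : ℕ × ℝ => rlPower a z (q.1 + q.2)) =O[𝓟 (Set.Ici 1 ×ˢ Set.Icc 0 1)]
      fun q => (q.1 : ℝ) ^ (z + a - 1).re := by
  refine Asymptotics.isBigO_principal.2
    ⟨‖Complex.Gamma z / Complex.Gamma (z + a)‖ * 2 ^ |(z + a - 1).re|, fun ⟨n, θ⟩ ⟨hn, hθ⟩ => ?_⟩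
  have hpos : (0 : ℝ) < n + θ := add_pos_of_pos_of_nonneg (by exact_mod_cast hn) hθ.1
  rw [rlPower, norm_mul, Complex.norm_cpow_eq_rpow_re_of_pos hpos, mul_assoc,
    Real.norm_of_nonneg (by positivity)]
  gcongr
  exact add_rpow_le hn hθ _

theorem IsConvergentOfOrder.shiftedError_isBigO {σ α : ℝ} {ω : ℕ → ℂ} {p : ℕ}
    (hω : IsConvergentOfOrder σ α ω p) (K : ℕ) :
    (fun q : ℕ × ℝ => shiftedError α ω K q.1 q.2) =O[𝓟 (Set.Ici 1 ×ˢ Set.Icc 0 1)]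
      fun q => (q.1 : ℝ) ^ (α - 1) + (q.1 : ℝ) ^ (α + K - p) := by
  have hzero : ∀ K : ℕ, (fun n => shiftedError α ω K n 0) =O[𝓟 (Set.Ici 1)]
      fun n : ℕ => (n : ℝ) ^ (α - 1) + (n : ℝ) ^ (α + K - p) := fun K => by
    have hK : ∀ k : ℕ, (K : ℂ) + 1 ≠ -(k : ℂ) := fun k e => by
      have : ((K + 1 + k : ℕ) : ℂ) = 0 := by push_cast; linear_combination e
      rw [Nat.cast_eq_zero] at this
      omega
    have hre : α + ((K : ℂ) + 1).re - 1 - p = α + K - p := by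
      simp only [Complex.add_re, Complex.natCast_re, Complex.one_re]; ring
    simpa only [shiftedError_zero, hre] using
      (hω.powerError_isBigO hK).const_mul_left (K.factorial : ℂ)⁻¹
  induction K with
  | zero =>
    have hre : ((1 : ℂ) + (α - 1) - 1).re = α - 1 := by simp
    refine isBigO_prod_Icc_of_hasDerivAt
      (fun n hn t ht => hasDerivAt_shiftedError_zero α ω hn ht.1) (hzero 0)
      ((hre ▸ rlPower_add_isBigO (α - 1) 1).neg_left.trans (Asymptotics.isBigO_of_le _ fun q => ?_))
    rw [Real.norm_of_nonneg (by positivity), Real.norm_of_nonneg (by positivity)]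
    exact le_add_of_nonneg_right (by positivity)
  | succ K ih =>
    refine isBigO_prod_Icc_of_hasDerivAt
      (fun n hn t ht => hasDerivAt_shiftedError_succ α ω K hn ht.1) (hzero (K + 1))
      (ih.trans (Asymptotics.isBigO_principal.2 ⟨1, fun q hq => ?_⟩))
    have hn1 : (1 : ℝ) ≤ q.1 := by exact_mod_cast hq.1
    rw [Real.norm_of_nonneg (by positivity), Real.norm_of_nonneg (by positivity), one_mul]
    gcongr
    exact K.le_succ

theorem continuous_shiftedError {α : ℝ} (ω : ℕ → ℂ) {K : ℕ} (hα : 0 < α + K) (n : ℕ) :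
    Continuous (shiftedError α ω K n) := by
  refine Continuous.sub (by fun_prop) (continuous_const.mul ?_)
  refine continuous_iff_continuousAt.2 fun θ => ?_
  refine ContinuousAt.comp (f := fun θ : ℝ => (n : ℝ) + θ)
    (Complex.continuousAt_ofReal_cpow_const _ _ (Or.inl ?_)) (by fun_prop)
  simpa using hα

theorem IsConvergentOfOrder.exists_norm_shiftedError_le {σ α : ℝ} {ω : ℕ → ℂ} {p : ℕ}
    (hω : IsConvergentOfOrder σ α ω p) {K : ℕ} (hpK : p ≤ K + 1) (hpα : p < α + K) :
    ∃ C, 0 ≤ C ∧ ∀ m : ℕ, ∀ θ ∈ Set.Icc (0 : ℝ) 1,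
      ‖shiftedError α ω K m θ‖ ≤ C * (1 + m : ℝ) ^ (α + K - p) := by
  obtain ⟨A, hA⟩ := (isCompact_Icc (a := (0 : ℝ)) (b := 1)).exists_bound_of_continuousOn
    (continuous_shiftedError ω (p.cast_nonneg.trans_lt hpα) 0).continuousOn
  obtain ⟨B, hB0, hB⟩ := (hω.shiftedError_isBigO K).exists_nonneg
  have hA0 : 0 ≤ A := (norm_nonneg _).trans (hA 0 ⟨le_rfl, zero_le_one⟩)
  refine ⟨A + 2 * B, by positivity, fun m θ hθ => ?_⟩
  rcases Nat.eq_zero_or_pos m with rfl | hm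
  · simpa using (hA θ hθ).trans (le_add_of_nonneg_right (by positivity))
  · have hm1 : (1 : ℝ) ≤ m := by exact_mod_cast hm
    have hpK' : (p : ℝ) ≤ K + 1 := by exact_mod_cast hpK
    have hle : (m : ℝ) ^ (α - 1) ≤ (m : ℝ) ^ (α + K - p) :=
      Real.rpow_le_rpow_of_exponent_le hm1 (by linarith)
    have hle' : (m : ℝ) ^ (α + K - p) ≤ (1 + m : ℝ) ^ (α + K - p) :=
      Real.rpow_le_rpow (by positivity) (by linarith) (by linarith)
    calc ‖shiftedError α ω K m θ‖
      _ ≤ B * ((m : ℝ) ^ (α - 1) + (m : ℝ) ^ (α + K - p)) := by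
        simpa only [Real.norm_of_nonneg (show 0 ≤ (m : ℝ) ^ (α - 1) + (m : ℝ) ^ (α + K - p) by
          positivity)] using (Asymptotics.isBigOWith_principal.1 hB) (m, θ) ⟨hm, hθ⟩
      _ ≤ B * (2 * (1 + m : ℝ) ^ (α + K - p)) := by
        gcongr
        linarith
      _ ≤ (A + 2 * B) * (1 + m : ℝ) ^ (α + K - p) := by
        rw [← mul_assoc, mul_comm B]
        gcongr
        linarith

/-! ### The Peano kernel -/

/-- The truncated power `x₊ ^ K / K!`. -/
noncomputable def truncatedPower (K : ℕ) (x : ℝ) : ℝ := max x 0 ^ K / K.factorial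

theorem continuous_truncatedPower (K : ℕ) : Continuous (truncatedPower K) := by
  unfold truncatedPower
  fun_prop

theorem truncatedPower_of_nonneg (K : ℕ) {x : ℝ} (hx : 0 ≤ x) :
    truncatedPower K x = x ^ K / K.factorial := by
  rw [truncatedPower, max_eq_left hx]

theorem truncatedPower_of_nonpos {K : ℕ} (hK : K ≠ 0) {x : ℝ} (hx : x ≤ 0) :
    truncatedPower K x = 0 := by
  rw [truncatedPower, max_eq_right hx, zero_pow hK, zero_div]

theorem truncatedPower_mul (K : ℕ) (x : ℝ) {h : ℝ} (hh : 0 ≤ h) :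
    truncatedPower K (x * h) = h ^ K * truncatedPower K x := by
  rw [truncatedPower, truncatedPower, ← zero_mul h, ← max_mul_of_nonneg _ _ hh, mul_pow, zero_mul]
  ring

/-- The Peano kernel of the untwisted quadrature: its error at `n * h` for the truncated power
`x ↦ (x - s)₊ ^ K / K!`. -/
noncomputable def peanoKernel (α : ℝ) (ω : ℕ → ℂ) (K : ℕ) (h : ℝ) (n : ℕ) (s : ℝ) : ℂ :=
  convQuad 0 α ω h n (fun x => (truncatedPower K (x - s) : ℂ)) - rlPower (α + K) 1 (n * h - s)

theorem peanoKernel_eq_shiftedError (α : ℝ) (ω : ℕ → ℂ) {K : ℕ} (hK : K ≠ 0) {h : ℝ} (hh : 0 < h)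
    (d m : ℕ) {θ : ℝ} (hθ : θ ∈ Set.Ico (0 : ℝ) 1) :
    peanoKernel α ω K h (d + m) ((d - θ) * h) =
      ((h ^ (α + K) : ℝ) : ℂ) * shiftedError α ω K m θ := by
  have hbefore : ∀ j ∈ Finset.range d,
      ω (d + m - j) * (truncatedPower K (j * h - (d - θ) * h) : ℂ) = 0 := fun j hj => by
    have hjd : (j : ℝ) + 1 ≤ d := by exact_mod_cast Finset.mem_range.1 hj
    rw [truncatedPower_of_nonpos hK, Complex.ofReal_zero, mul_zero]
    nlinarith [hθ.2]
  have hafter : ∀ i ∈ Finset.range (m + 1),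
      ω (d + m - (d + i)) * (truncatedPower K ((d + i : ℕ) * h - (d - θ) * h) : ℂ) =
        ((h ^ K : ℝ) : ℂ) * (ω (m - i) * (((i + θ) ^ K / K.factorial : ℝ) : ℂ)) := fun i _ => by
    rw [Nat.add_sub_add_left, show ((d + i : ℕ) * h - (d - θ) * h : ℝ) = (i + θ) * h by
      push_cast; ring, truncatedPower_mul K _ hh.le,
      truncatedPower_of_nonneg K (add_nonneg i.cast_nonneg hθ.1), Complex.ofReal_mul]
    ring
  have hpow : rlPower (α + K) 1 ((d + m : ℕ) * h - (d - θ) * h) =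
      ((h ^ (α + K) : ℝ) : ℂ) * rlPower (α + K) 1 (m + θ) := by
    rw [show ((d + m : ℕ) * h - (d - θ) * h : ℝ) = (m + θ) * h by push_cast; ring,
      rlPower_mul _ _ (add_nonneg m.cast_nonneg hθ.1) hh.le, Complex.ofReal_cpow hh.le]
    push_cast
    ring_nf
  rw [peanoKernel, convQuad_zero, add_assoc, Finset.sum_range_add, Finset.sum_eq_zero hbefore,
    zero_add, Finset.sum_congr rfl hafter, ← Finset.mul_sum, hpow, shiftedError, mul_sub,
    Real.rpow_add hh, Real.rpow_natCast]
  push_cast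
  ring

/-- The step sizes and indices `(h, n)` of the grid points `n * h` in `(0, X]`, the index set of
error bounds that are uniform for bounded `x = n * h`. -/
def meshes (X : ℝ) : Set (ℝ × ℕ) := {q | 0 < q.1 ∧ 1 ≤ q.2 ∧ q.2 * q.1 ≤ X}

theorem step_le_of_mem_meshes {X : ℝ} {q : ℝ × ℕ} (hq : q ∈ meshes X) : q.1 ≤ X :=
  (le_mul_of_one_le_left hq.1.le (by exact_mod_cast hq.2.1)).trans hq.2.2

theorem IsConvergentOfOrder.exists_norm_peanoKernel_le {σ α : ℝ} {ω : ℕ → ℂ} {p : ℕ}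
    (hω : IsConvergentOfOrder σ α ω p) {K : ℕ} (hK : K ≠ 0) (hpK : p ≤ K + 1) (hpα : p < α + K)
    (X : ℝ) :
    ∃ C, ∀ q ∈ meshes X, ∀ s ∈ Set.Ioc 0 (q.2 * q.1),
      ‖peanoKernel α ω K q.1 q.2 s‖ ≤ C * q.1 ^ p := by
  obtain ⟨C, hC0, hC⟩ := hω.exists_norm_shiftedError_le hpK hpα
  refine ⟨C * (2 * X) ^ (α + K - p), fun ⟨h, n⟩ hq s hs => ?_⟩
  have hhX : h ≤ X := step_le_of_mem_meshes hq
  obtain ⟨hh, -, hX⟩ := hq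
  dsimp only at hh hX hs ⊢
  have ht : 0 ≤ n - s / h := sub_nonneg.2 ((div_le_iff₀ hh).2 hs.2)
  have htn : n - s / h ≤ n := sub_le_self _ (div_nonneg hs.1.le hh.le)
  obtain ⟨d, hd⟩ := Nat.exists_eq_add_of_le' (Nat.floor_le_of_le htn)
  set m := ⌊(n : ℝ) - s / h⌋₊
  have hm : (m : ℝ) ≤ n := by exact_mod_cast hd ▸ Nat.le_add_left m d
  have hθ : n - s / h - m ∈ Set.Ico (0 : ℝ) 1 :=
    ⟨sub_nonneg.2 (Nat.floor_le ht), by linarith [Nat.lt_floor_add_one ((n : ℝ) - s / h)]⟩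
  have hs_eq : s = (d - (n - s / h - m)) * h := by
    rw [hd]
    push_cast
    field_simp
    ring
  calc ‖peanoKernel α ω K h n s‖
    _ = h ^ (α + K) * ‖shiftedError α ω K m (n - s / h - m)‖ := by
      rw [← Real.norm_of_nonneg (Real.rpow_nonneg hh.le (α + K)), ← Complex.norm_real, ← norm_mul,
        ← peanoKernel_eq_shiftedError α ω hK hh d m hθ, ← hs_eq, ← hd]
    _ ≤ h ^ (α + K) * (C * (1 + m : ℝ) ^ (α + K - p)) := by
      gcongr
      exact hC m _ ⟨hθ.1, hθ.2.le⟩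
    _ = C * ((1 + m) * h) ^ (α + K - p) * h ^ p := by
      rw [Real.mul_rpow (by positivity) hh.le, ← Real.rpow_natCast h p, mul_assoc, mul_assoc,
        ← Real.rpow_add hh, sub_add_cancel]
      ring
    _ ≤ C * (2 * X) ^ (α + K - p) * h ^ p := by
      refine mul_le_mul_of_nonneg_right (mul_le_mul_of_nonneg_left
        (Real.rpow_le_rpow (by positivity) ?_ (by linarith)) hC0) (by positivity)
      nlinarith

theorem eq_integral_truncatedPower_mul_iteratedDeriv {K : ℕ} (hK : K ≠ 0) {F : ℝ → ℂ}
    (hF : ContDiff ℝ (K + 1 : ℕ) F) (h0 : ∀ x ≤ 0, F x = 0) {y x : ℝ} (hy : 0 ≤ y) (hyx : y ≤ x) :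
    F y = ∫ s in (0 : ℝ)..x, (truncatedPower K (y - s) : ℂ) * iteratedDeriv (K + 1) F s := by
  have hcont : Continuous fun s : ℝ =>
      (truncatedPower K (y - s) : ℂ) * iteratedDeriv (K + 1) F s := by
    have := continuous_truncatedPower K
    fun_prop
  have hbeyond : ∫ s in y..x, (truncatedPower K (y - s) : ℂ) * iteratedDeriv (K + 1) F s = 0 := by
    refine intervalIntegral.integral_zero_ae (ae_of_all _ fun s hs => ?_)
    rw [Set.uIoc_of_le hyx] at hs
    rw [truncatedPower_of_nonpos hK (sub_nonpos.2 hs.1.le), Complex.ofReal_zero, zero_mul]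
  rw [← intervalIntegral.integral_add_adjacent_intervals (hcont.intervalIntegrable 0 y)
    (hcont.intervalIntegrable y x), hbeyond, add_zero,
    eq_rlIntegral_iteratedDeriv K.succ_ne_zero hF h0 hy, rlIntegral,
    ← intervalIntegral.integral_const_mul]
  refine intervalIntegral.integral_congr fun s hs => ?_
  rw [Set.uIcc_of_le hy] at hs
  rw [truncatedPower_of_nonneg K (sub_nonneg.2 hs.2), Nat.cast_add_one,
    Real.Gamma_nat_eq_factorial, add_sub_cancel_right, Real.rpow_natCast]
  push_cast
  ring

theorem rlPower_one_of_nonneg (a : ℝ) {x : ℝ} (hx : 0 ≤ x) :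
    rlPower a 1 x = ((1 / Real.Gamma (a + 1) : ℝ) : ℂ) * ((x ^ a : ℝ) : ℂ) := by
  rw [rlPower, Complex.Gamma_one, Complex.ofReal_cpow hx, add_sub_cancel_left, Complex.ofReal_div,
    ← Complex.Gamma_ofReal, add_comm]
  push_cast
  rfl

theorem convQuad_sub_rlIntegral_eq_integral_peanoKernel {α : ℝ} (ω : ℕ → ℂ) {K : ℕ} (hK : K ≠ 0)
    (hα : 0 ≤ α + K) {F : ℝ → ℂ} (hF : ContDiff ℝ (K + 1 : ℕ) F) (h0 : ∀ x ≤ 0, F x = 0) {h : ℝ}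
    (hh : 0 ≤ h) (n : ℕ) :
    convQuad 0 α ω h n F - rlIntegral (α + (K + 1 : ℕ)) (iteratedDeriv (K + 1) F) (n * h) =
      ∫ s in (0 : ℝ)..n * h, peanoKernel α ω K h n s * iteratedDeriv (K + 1) F s := by
  set G := iteratedDeriv (K + 1) F
  have hG : Continuous G := hF.continuous_iteratedDeriv' (K + 1)
  have htrunc := continuous_truncatedPower K
  have hnh : 0 ≤ n * h := by positivity
  have hconv : convQuad 0 α ω h n F = ∫ s in (0 : ℝ)..n * h,
      convQuad 0 α ω h n (fun x => (truncatedPower K (x - s) : ℂ)) * G s := by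
    simp only [convQuad_zero, Finset.mul_sum, Finset.sum_mul]
    rw [intervalIntegral.integral_finsetSum fun j _ =>
      Continuous.intervalIntegrable (by fun_prop) _ _]
    refine Finset.sum_congr rfl fun j hj => ?_
    have hjn : (j : ℝ) ≤ n := by exact_mod_cast Nat.lt_succ_iff.1 (Finset.mem_range.1 hj)
    rw [eq_integral_truncatedPower_mul_iteratedDeriv hK hF h0 (by positivity)
      (mul_le_mul_of_nonneg_right hjn hh), ← mul_assoc, ← intervalIntegral.integral_const_mul]
    simp only [mul_assoc]
    rfl
  have hintegrable := intervalIntegrable_rpow_sub_mul (ν := α + (K + 1 : ℕ))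
    (by push_cast; linarith) hG 0 (n * h) (n * h)
  rw [hconv, rlIntegral, ← intervalIntegral.integral_const_mul, ← intervalIntegral.integral_sub
    (Continuous.intervalIntegrable (by simp only [convQuad_zero]; fun_prop) _ _)
    (hintegrable.const_mul _)]
  refine intervalIntegral.integral_congr fun s hs => ?_
  rw [Set.uIcc_of_le hnh] at hs
  have hpow := rlPower_one_of_nonneg (α + K) (sub_nonneg.2 hs.2)
  push_cast at hpow
  rw [peanoKernel, hpow]
  push_cast
  rw [← add_assoc, add_sub_cancel_right]
  ring

theorem IsConvergentOfOrder.convQuad_sub_rlIntegral_isBigO {σ α : ℝ} {ω : ℕ → ℂ} {p : ℕ}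
    (hω : IsConvergentOfOrder σ α ω p) {K : ℕ} (hK : K ≠ 0) (hpK : p ≤ K + 1) (hpα : p < α + K)
    {F : ℝ → ℂ} (hF : ContDiff ℝ (K + 1 : ℕ) F) (h0 : ∀ x ≤ 0, F x = 0) (X : ℝ) :
    (fun q : ℝ × ℕ => convQuad 0 α ω q.1 q.2 F -
        rlIntegral (α + (K + 1 : ℕ)) (iteratedDeriv (K + 1) F) (q.2 * q.1)) =O[𝓟 (meshes X)]
      fun q => q.1 ^ p := by
  obtain ⟨C, hC⟩ := hω.exists_norm_peanoKernel_le hK hpK hpα X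
  obtain ⟨M, hM⟩ := (isCompact_Icc (a := 0) (b := X)).exists_bound_of_continuousOn
    (hF.continuous_iteratedDeriv' (K + 1)).continuousOn
  refine Asymptotics.isBigO_principal.2 ⟨C * M * X, fun ⟨h, n⟩ hq => ?_⟩
  obtain ⟨hh, hn, hX⟩ := id hq
  dsimp only at hh hn hX ⊢
  have hnh : 0 < n * h := mul_pos (by exact_mod_cast hn) hh
  have hint : ∀ s ∈ Set.uIoc 0 (n * h),
      ‖peanoKernel α ω K h n s * iteratedDeriv (K + 1) F s‖ ≤ C * h ^ p * M := fun s hs => by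
    rw [Set.uIoc_of_le hnh.le] at hs
    rw [norm_mul]
    exact mul_le_mul (hC _ hq s hs) (hM s ⟨hs.1.le, hs.2.trans hX⟩) (norm_nonneg _)
      ((norm_nonneg _).trans (hC _ hq s hs))
  have hnonneg : 0 ≤ C * h ^ p * M := (norm_nonneg _).trans
    (hint (n * h) (by rw [Set.uIoc_of_le hnh.le]; exact ⟨hnh, le_rfl⟩))
  rw [convQuad_sub_rlIntegral_eq_integral_peanoKernel ω hK (p.cast_nonneg.trans hpα.le) hF h0 hh.le,
    Real.norm_of_nonneg (by positivity)]
  calc _ ≤ C * h ^ p * M * |n * h - 0| := intervalIntegral.norm_integral_le_of_norm_le_const hint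
    _ ≤ C * h ^ p * M * X := by
      rw [sub_zero, abs_of_pos hnh]
      gcongr
    _ = C * M * X * h ^ p := by ring

/-! ### Starting weights -/

/-- The matrix of the system for the starting weights: its entries are the values at
`1, …, r` of the powers `x ^ (q + β - 1)`, `0 ≤ q < r`. The column with index `j` belongs to the
node `j + 1`. -/
noncomputable def powerMatrix (β : ℂ) (r : ℕ) : Matrix (Fin r) (Fin r) ℂ :=
  Matrix.of fun q j => ((j + 1 : ℕ) : ℂ) ^ ((q : ℂ) + β - 1)

theorem isUnit_det_powerMatrix (β : ℂ) (r : ℕ) : IsUnit (powerMatrix β r).det := by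
  have hnode : ∀ j : ℕ, ((j + 1 : ℕ) : ℂ) ≠ 0 := fun j => by exact_mod_cast j.succ_ne_zero
  have hfactor : powerMatrix β r =
      (Matrix.vandermonde fun j : Fin r => ((j + 1 : ℕ) : ℂ)).transpose *
        Matrix.diagonal fun j : Fin r => ((j + 1 : ℕ) : ℂ) ^ (β - 1) := by
    ext q j
    rw [Matrix.mul_diagonal, Matrix.transpose_apply, Matrix.vandermonde_apply, powerMatrix,
      Matrix.of_apply, add_sub_assoc, Complex.cpow_add _ _ (hnode j), Complex.cpow_natCast]
  rw [hfactor, Matrix.det_mul, Matrix.det_transpose, Matrix.det_diagonal, isUnit_iff_ne_zero]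
  refine mul_ne_zero (Matrix.det_vandermonde_ne_zero_iff.2 fun i j hij => ?_)
    (Finset.prod_ne_zero_iff.2 fun j _ => Complex.cpow_ne_zero_iff.2 (Or.inl (hnode j)))
  exact Fin.ext (Nat.succ_injective (Nat.cast_injective hij))

/-- The starting weights for `σ = 0`, which do not depend on the step size: they solve the linear
system with matrix `powerMatrix β r` whose right-hand side consists of the errors for the powers.
They are indexed by `1 ≤ j ≤ r`. -/
noncomputable def startingWeight (α : ℝ) (β : ℂ) (ω : ℕ → ℂ) (r n j : ℕ) : ℂ :=
  if hj : j - 1 < r then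
    ((powerMatrix β r)⁻¹.mulVec fun q : Fin r => -powerError α ω (q + β) n) ⟨j - 1, hj⟩
  else 0

theorem startingWeight_succ (α : ℝ) (β : ℂ) (ω : ℕ → ℂ) {r : ℕ} (n : ℕ) (j : Fin r) :
    startingWeight α β ω r n (j + 1) =
      (powerMatrix β r)⁻¹.mulVec (fun q : Fin r => -powerError α ω (q + β) n) j :=
  dif_pos j.isLt

theorem sum_startingWeight_mul_cpow (α : ℝ) (β : ℂ) (ω : ℕ → ℂ) {r q : ℕ} (hq : q < r) (n : ℕ) :
    ∑ j ∈ Finset.Icc 1 r, startingWeight α β ω r n j * (j : ℂ) ^ ((q : ℂ) + β - 1) =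
      -powerError α ω (q + β) n := by
  set d : Fin r → ℂ := fun q => -powerError α ω (q + β) n
  have hsolve : (powerMatrix β r).mulVec ((powerMatrix β r)⁻¹.mulVec d) ⟨q, hq⟩ = d ⟨q, hq⟩ := by
    rw [Matrix.mulVec_mulVec, Matrix.mul_nonsing_inv _ (isUnit_det_powerMatrix β r),
      Matrix.one_mulVec]
  rw [← Finset.Ico_add_one_right_eq_Icc, Finset.sum_Ico_eq_sum_range, Nat.add_sub_cancel,
    Finset.sum_range, ← show d ⟨q, hq⟩ = -powerError α ω (q + β) n from rfl, ← hsolve,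
    Matrix.mulVec, dotProduct]
  refine Finset.sum_congr rfl fun j _ => ?_
  rw [add_comm 1 (j : ℕ), startingWeight_succ, mul_comm, powerMatrix, Matrix.of_apply]

theorem IsConvergentOfOrder.startingWeight_isBigO {σ α : ℝ} {ω : ℕ → ℂ} {p : ℕ}
    (hω : IsConvergentOfOrder σ α ω p) {β : ℂ} (hβ : ∀ k : ℕ, β ≠ -(k : ℂ)) {r : ℕ}
    (hr : p + 1 ≤ β.re + r) (j : ℕ) :
    (fun n => startingWeight α β ω r n j) =O[𝓟 (Set.Ici 1)]
      fun n : ℕ => (n : ℝ) ^ (α + β.re + r - 2 - p) := by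
  have hpow : ∀ {a : ℝ}, a ≤ α + β.re + r - 2 - p → (fun n : ℕ => (n : ℝ) ^ a) =O[𝓟 (Set.Ici 1)]
      fun n : ℕ => (n : ℝ) ^ (α + β.re + r - 2 - p) := fun ha => by
    refine Asymptotics.IsBigO.of_bound 1 (eventually_principal.2 fun n hn => ?_)
    rw [one_mul, Real.norm_of_nonneg (by positivity), Real.norm_of_nonneg (by positivity)]
    exact Real.rpow_le_rpow_of_exponent_le (by exact_mod_cast hn) ha
  have herror : ∀ q : Fin r, (fun n => -powerError α ω (q + β) n) =O[𝓟 (Set.Ici 1)]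
      fun n : ℕ => (n : ℝ) ^ (α + β.re + r - 2 - p) := fun q => by
    have hq : (q : ℝ) + 1 ≤ r := by exact_mod_cast q.isLt
    refine (hω.powerError_isBigO fun k hk => hβ (k + q) ?_).neg_left.trans
      ((hpow (by linarith)).add (hpow ?_))
    · push_cast
      linear_combination hk
    · rw [Complex.add_re, Complex.natCast_re]
      linarith
  unfold startingWeight
  split_ifs
  · simp only [Matrix.mulVec, dotProduct]
    exact Asymptotics.IsBigO.fun_sum fun q _ => (herror q).const_mul_left _
  · exact Asymptotics.isBigO_zero _ _

theorem exp_mul_mul_exp (σ h : ℝ) (n j : ℕ) (a : ℂ) :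
    (Real.exp (-σ * (n * h - j * h)) : ℂ) * a * (Real.exp (-σ * (j * h)) : ℂ) =
      (Real.exp (-σ * (n * h)) : ℂ) * a := by
  rw [mul_right_comm, ← Complex.ofReal_mul, ← Real.exp_add, ← mul_add, sub_add_cancel]

theorem startingSystem_exp_mul_startingWeight (σ α : ℝ) (β : ℂ) (ω : ℕ → ℂ) (r : ℕ) (h : ℝ)
    (n : ℕ) :
    StartingSystem σ α β ω r
      (fun n j => (Real.exp (-σ * (n * h - j * h)) : ℂ) * startingWeight α β ω r n j) h n := by
  intro q hq
  have hquad : ∑ j ∈ Finset.range (n + 1), convWeight σ ω h (n - j) *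
      (Real.exp (-σ * (j * h)) : ℂ) * (j : ℂ) ^ ((q : ℂ) + β - 1) =
      (Real.exp (-σ * (n * h)) : ℂ) *
        ∑ j ∈ Finset.range (n + 1), ω (n - j) * (j : ℂ) ^ ((q : ℂ) + β - 1) := by
    rw [Finset.mul_sum]
    refine Finset.sum_congr rfl fun j hj => ?_
    rw [convWeight_mul_exp σ ω h (Nat.lt_succ_iff.1 (Finset.mem_range.1 hj)), mul_assoc]
  simp only [exp_mul_mul_exp, mul_assoc (Real.exp (-σ * (n * h)) : ℂ)]
  rw [hquad, ← Finset.mul_sum, sum_startingWeight_mul_cpow α β ω hq, powerError, rlPower]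
  rw [show (α : ℂ) + q + β = q + β + α by ring, show (q : ℂ) + α + β - 1 = q + β + α - 1 by ring,
    Complex.ofReal_natCast]
  ring

/-! ### The corrected quadrature -/

theorem correctedQuad_exp_mul (σ α : ℝ) (ω : ℕ → ℂ) (r : ℕ) (v : ℕ → ℕ → ℂ) (h : ℝ) (n : ℕ)
    (u : ℝ → ℂ) :
    correctedQuad σ α ω r (fun n j => (Real.exp (-σ * (n * h - j * h)) : ℂ) * v n j) h n
        (fun x => (Real.exp (-σ * x) : ℂ) * u x) =
      (Real.exp (-σ * (n * h)) : ℂ) * correctedQuad 0 α ω r v h n u := by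
  rw [correctedQuad, convQuad_exp_mul, correctedQuad, mul_add,
    mul_left_comm (Real.exp _ : ℂ), Finset.mul_sum _ _ (Real.exp _ : ℂ)]
  congr 2
  refine Finset.sum_congr rfl fun j _ => ?_
  rw [← mul_assoc, exp_mul_mul_exp, mul_assoc]

theorem correctedQuad_congr {σ α : ℝ} {ω : ℕ → ℂ} {r : ℕ} {w : ℕ → ℕ → ℂ} {h : ℝ} (hh : 0 ≤ h)
    {n : ℕ} {f g : ℝ → ℂ} (hfg : Set.EqOn f g (Set.Ici 0)) :
    correctedQuad σ α ω r w h n f = correctedQuad σ α ω r w h n g := by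
  have hnode : ∀ j : ℕ, f (j * h) = g (j * h) := fun j => hfg (mul_nonneg j.cast_nonneg hh)
  simp only [correctedQuad, convQuad, hnode]

theorem correctedQuad_sum_const_mul_add {ι : Type*} (s : Finset ι) (σ α : ℝ) (ω : ℕ → ℂ) (r : ℕ)
    (w : ℕ → ℕ → ℂ) (h : ℝ) (n : ℕ) (c : ι → ℂ) (φ : ι → ℝ → ℂ) (F : ℝ → ℂ) :
    correctedQuad σ α ω r w h n (fun x => ∑ i ∈ s, c i * φ i x + F x) =
      ∑ i ∈ s, c i * correctedQuad σ α ω r w h n (φ i) + correctedQuad σ α ω r w h n F := by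
  have hswap : ∀ (t : Finset ℕ) (a : ℕ → ℂ) (x : ℕ → ℝ),
      ∑ j ∈ t, a j * ∑ i ∈ s, c i * φ i (x j) = ∑ i ∈ s, c i * ∑ j ∈ t, a j * φ i (x j) :=
    fun t a x => by
      simp only [Finset.mul_sum, mul_left_comm (a _)]
      exact Finset.sum_comm
  simp only [correctedQuad, convQuad, mul_add, Finset.sum_add_distrib, hswap,
    mul_left_comm (c _), ← Finset.mul_sum]
  ring

theorem correctedQuad_startingWeight_cpow {h : ℝ} (hh : 0 < h) (α : ℝ) (β : ℂ) (ω : ℕ → ℂ)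
    {r q : ℕ} (hq : q < r) (n : ℕ) :
    correctedQuad 0 α ω r (startingWeight α β ω r) h n (fun x => (x : ℂ) ^ ((q : ℂ) + β - 1)) =
      rlPower α (q + β) (n * h) := by
  have hstart : ((h ^ α : ℝ) : ℂ) * ∑ j ∈ Finset.Icc 1 r,
      startingWeight α β ω r n j * ((j * h : ℝ) : ℂ) ^ ((q : ℂ) + β - 1) =
      (h : ℂ) ^ ((q : ℂ) + β + α - 1) * -powerError α ω (q + β) n := by
    rw [← sum_startingWeight_mul_cpow α β ω hq n, Finset.mul_sum, Finset.mul_sum]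
    simp only [mul_left_comm _ (startingWeight α β ω r n _), rpow_mul_cpow_mul hh]
  rw [correctedQuad, hstart, mul_neg, ← convQuad_cpow_sub_rlPower hh]
  ring

theorem natCast_rpow_isBigO_rpow_neg {E : ℝ} (hE : 0 ≤ E) (X : ℝ) :
    (fun q : ℝ × ℕ => (q.2 : ℝ) ^ E) =O[𝓟 (meshes X)] fun q => q.1 ^ (-E) := by
  refine Asymptotics.isBigO_principal.2 ⟨X ^ E, fun ⟨h, n⟩ ⟨hh, hn, hX⟩ => ?_⟩
  dsimp only at hh hn hX ⊢
  have hX0 : 0 ≤ X := (by positivity : 0 ≤ n * h).trans hX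
  rw [Real.norm_of_nonneg (by positivity), Real.norm_of_nonneg (by positivity),
    Real.rpow_neg hh.le, ← div_eq_mul_inv, ← Real.div_rpow hX0 hh.le]
  exact Real.rpow_le_rpow n.cast_nonneg ((le_div_iff₀ hh).2 hX) hE

theorem VanishesToOrder.cpowMulPos_isBigO {N : ℕ} {R : ℝ → ℂ} (hR : VanishesToOrder N R) (γ : ℂ)
    (j : ℕ) (X : ℝ) :
    (fun h : ℝ => cpowMulPos γ R (j * h)) =O[𝓟 (Set.Ioc 0 X)] fun h => h ^ (γ.re + N) := by
  obtain ⟨C, hC⟩ := exists_norm_cpowMulPos_le hR γ (j * X)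
  refine Asymptotics.isBigO_principal.2 ⟨C * (j : ℝ) ^ (γ.re + N), fun h hh => ?_⟩
  have hbound := hC (j * h) (mul_le_mul_of_nonneg_left hh.2 j.cast_nonneg)
  rwa [abs_of_nonneg (mul_nonneg j.cast_nonneg hh.1.le), Real.mul_rpow j.cast_nonneg hh.1.le,
    ← mul_assoc, ← Real.norm_of_nonneg (Real.rpow_nonneg hh.1.le (γ.re + N))] at hbound

/-- The growth of the starting weights with `n` is compensated by the order to which `F` vanishes
at `0`. -/
theorem startingSum_isBigO {α E e X : ℝ} {r p : ℕ} (hE : 0 ≤ E) (hsum : α + e - E = p + 1)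
    {v : ℕ → ℕ → ℂ} (hv : ∀ j, (fun n => v n j) =O[𝓟 (Set.Ici 1)] fun n : ℕ => (n : ℝ) ^ E)
    {F : ℝ → ℂ} (hF : ∀ j : ℕ, (fun h : ℝ => F (j * h)) =O[𝓟 (Set.Ioc 0 X)] fun h => h ^ e) :
    (fun q : ℝ × ℕ => ((q.1 ^ α : ℝ) : ℂ) * ∑ j ∈ Finset.Icc 1 r, v q.2 j * F (j * q.1))
      =O[𝓟 (meshes X)] fun q => q.1 ^ p := by
  have hstep : Tendsto Prod.fst (𝓟 (meshes X)) (𝓟 (Set.Ioc 0 X)) :=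
    tendsto_principal_principal.2 fun q hq => ⟨hq.1, step_le_of_mem_meshes hq⟩
  have hindex : Tendsto Prod.snd (𝓟 (meshes X)) (𝓟 (Set.Ici 1)) :=
    tendsto_principal_principal.2 fun q hq => hq.2.1
  have hα : (fun q : ℝ × ℕ => ((q.1 ^ α : ℝ) : ℂ)) =O[𝓟 (meshes X)] fun q => q.1 ^ α :=
    Asymptotics.isBigO_of_le _ fun q => (Complex.norm_real _).le
  have hterms : (fun q : ℝ × ℕ => ∑ j ∈ Finset.Icc 1 r, v q.2 j * F (j * q.1)) =O[𝓟 (meshes X)]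
      fun q => q.1 ^ (-E) * q.1 ^ e := Asymptotics.IsBigO.fun_sum fun j _ =>
    (((hv j).comp_tendsto hindex).trans (natCast_rpow_isBigO_rpow_neg hE X)).mul
      ((hF j).comp_tendsto hstep)
  refine (hα.mul hterms).trans (Asymptotics.isBigO_principal.2 ⟨X, fun q hq => ?_⟩)
  have hh : 0 < q.1 := hq.1
  rw [← Real.rpow_add hh, ← Real.rpow_add hh, show α + (-E + e) = ((p + 1 : ℕ) : ℝ) by
    push_cast; linarith, Real.rpow_natCast, pow_succ', norm_mul, Real.norm_of_nonneg hh.le]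
  exact mul_le_mul_of_nonneg_right (step_le_of_mem_meshes hq) (norm_nonneg _)

/-- Conditions under which `r` starting weights yield order `p` for all `x ^ (β - 1) * g x` with `g`
of class `C^r`: the remainder of `x ^ (β - 1) * g x` after `r` powers is of class `C^(K+1)`, which
is enough for the Peano kernel of degree `K` to be `O(h^p)` and for `I^α` to be defined, and it
vanishes fast enough to compensate the growth of the weights. -/
structure IsSufficientOrder (α : ℝ) (β : ℂ) (p K r : ℕ) : Prop where
  ne_zero : K ≠ 0
  le_succ : p ≤ K + 1
  lt_add : p < α + K
  derivOrder_le : derivOrder (-α) ≤ K + 1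
  succ_le : K + 1 ≤ r
  succ_lt : ((K + 1 : ℕ) : ℝ) < (β - 1).re + r
  add_two_le : p + 2 ≤ α + β.re + r

theorem exists_isSufficientOrder (α : ℝ) (β : ℂ) (p : ℕ) : ∃ K r, IsSufficientOrder α β p K r := by
  have hnat : ∀ᶠ K : ℕ in atTop, p + derivOrder (-α) + 1 ≤ K := eventually_ge_atTop _
  have hreal : ∀ a : ℝ, ∀ᶠ K : ℕ in atTop, a < K := fun a =>
    tendsto_natCast_atTop_atTop.eventually_gt_atTop a
  obtain ⟨K, hK, hpα⟩ := (hnat.and (hreal (p - α))).exists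
  obtain ⟨r, hKr, hr, hrα⟩ := ((eventually_ge_atTop (K + 1)).and
    ((hreal ((K + 1 : ℕ) - (β - 1).re)).and (hreal (p + 2 - α - β.re)))).exists
  exact ⟨K, r, by omega, by omega, by linarith, by omega, hKr, by linarith, by linarith⟩

theorem IsConvergentOfOrder.exists_hasRLDifferintegral_correctedQuad_sub_isBigO {σ α : ℝ}
    {ω : ℕ → ℂ} {p : ℕ} (hω : IsConvergentOfOrder σ α ω p) {β : ℂ} (hβ : ∀ k : ℕ, β ≠ -(k : ℂ))
    {K r : ℕ} (hKr : IsSufficientOrder α β p K r) {g : ℝ → ℂ}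
    (hg : ContDiffOn ℝ r g (Set.Ici 0)) :
    ∃ I, HasRLDifferintegral α (fun x => (x : ℂ) ^ (β - 1) * g x) I ∧ ∀ X,
      (fun q : ℝ × ℕ => correctedQuad 0 α ω r (startingWeight α β ω r) q.1 q.2
        (fun x => (x : ℂ) ^ (β - 1) * g x) - I (q.2 * q.1)) =O[𝓟 (meshes X)] fun q => q.1 ^ p := by
  obtain ⟨c, R, hR, hsplit⟩ := exists_cpow_mul_eq_sum_add_cpowMulPos hβ
    (Nat.ne_of_gt (K.succ_pos.trans_le hKr.succ_le)) hg
  set F := cpowMulPos (β - 1) R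
  have hF : ContDiff ℝ (K + 1 : ℕ) F := contDiff_cpowMulPos hKr.succ_le hR hKr.succ_lt
  have hF0 : ∀ x ≤ 0, F x = 0 := fun x hx => cpowMulPos_of_nonpos hx
  have hpowers : ∀ q ∈ Finset.range r, HasRLDifferintegral α
      (fun x => c q * (x : ℂ) ^ ((q : ℂ) + β - 1)) fun x => c q * rlPower α (q + β) x :=
    fun q _ => (hasRLDifferintegral_cpow α fun k hk =>
      hβ (k + q) (by push_cast; linear_combination hk)).const_mul (c q)
  refine ⟨_, (HasRLDifferintegral.sum_add _ hpowers
    (hasRLDifferintegral_of_contDiff hKr.derivOrder_le hF hF0)).congr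
      fun x hx => (hsplit x (le_of_lt hx)).symm, fun X => ?_⟩
  have hre : (β - 1).re = β.re - 1 := by simp
  have hle_succ : (p : ℝ) ≤ (K + 1 : ℕ) := by exact_mod_cast hKr.le_succ
  have hsucc_lt := hKr.succ_lt
  have hquad := hω.convQuad_sub_rlIntegral_isBigO hKr.ne_zero hKr.le_succ hKr.lt_add hF hF0 X
  have hstart := startingSum_isBigO (α := α) (r := r) (p := p) (F := F)
    (by linarith [hKr.add_two_le]) (by rw [hre]; ring) (hω.startingWeight_isBigO hβ (by linarith))
    fun j => hR.cpowMulPos_isBigO (β - 1) j X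
  refine (hquad.add hstart).congr' (eventually_principal.2 fun q hq => ?_) .rfl
  have hexact : ∀ k ∈ Finset.range r, c k * correctedQuad 0 α ω r (startingWeight α β ω r) q.1 q.2
      (fun x => (x : ℂ) ^ ((k : ℂ) + β - 1)) = c k * rlPower α (k + β) (q.2 * q.1) := fun k hk => by
    rw [correctedQuad_startingWeight_cpow hq.1 α β ω (Finset.mem_range.1 hk)]
  dsimp only
  rw [correctedQuad_congr (le_of_lt hq.1) hsplit, correctedQuad_sum_const_mul_add,
    Finset.sum_congr rfl hexact, correctedQuad]
  ring

theorem exp_neg_mul_isBigO_one (σ X : ℝ) :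
    (fun q : ℝ × ℕ => (Real.exp (-σ * (q.2 * q.1)) : ℂ)) =O[𝓟 (meshes X)] fun _ => (1 : ℝ) := by
  refine Asymptotics.isBigO_principal.2 ⟨Real.exp (|σ| * X), fun ⟨h, n⟩ ⟨hh, _, hX⟩ => ?_⟩
  rw [Complex.norm_real, Real.norm_of_nonneg (Real.exp_pos _).le, norm_one, mul_one]
  exact Real.exp_le_exp.2 (mul_le_mul (neg_le_abs σ) hX (mul_nonneg n.cast_nonneg (le_of_lt hh))
    (abs_nonneg σ))

end SubstantialCalculus

theorem theorem4p13_general (α : ℝ) (β : ℂ) (p : ℕ) (hβ : ∀ k : ℕ, β ≠ -(k : ℂ)) :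
    ∃ N r : ℕ, ∀ (σ : ℝ) (ω : ℕ → ℂ), IsConvergentOfOrder σ α ω p →
      ∃ w : ℝ → ℕ → ℕ → ℂ,
        (∀ h : ℝ, 0 < h → ∀ n : ℕ, 1 ≤ n → StartingSystem σ α β ω r (w h) h n) ∧
        ∀ g : ℝ → ℂ, ContDiffOn ℝ N g (Set.Ici 0) →
          SubstOpExists σ α (fun x => (x : ℂ) ^ (β - 1) * g x) ∧
          ∀ X : ℝ, 0 < X → ∃ C : ℝ, ∀ h : ℝ, 0 < h → ∀ n : ℕ, 1 ≤ n → n * h ≤ X →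
            ‖correctedQuad σ α ω r (w h) h n (fun x => (x : ℂ) ^ (β - 1) * g x) -
              substOp σ α (fun x => (x : ℂ) ^ (β - 1) * g x) (n * h)‖ ≤ C * h ^ p := by
  obtain ⟨K, r, hKr⟩ := exists_isSufficientOrder α β p
  refine ⟨r, r, fun σ ω hω => ⟨fun h n j =>
    (Real.exp (-σ * (n * h - j * h)) : ℂ) * startingWeight α β ω r n j,
    fun h _ n _ => startingSystem_exp_mul_startingWeight σ α β ω r h n, fun g hg => ?_⟩⟩
  set u : ℝ → ℂ := fun x => (x : ℂ) ^ (β - 1) * ((Real.exp (σ * x) : ℂ) * g x) with hu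
  have hf : (fun x : ℝ => (x : ℂ) ^ (β - 1) * g x) = fun x => (Real.exp (-σ * x) : ℂ) * u x := by
    funext x
    rw [hu, neg_mul, Real.exp_neg, Complex.ofReal_inv]
    field_simp
  obtain ⟨I, hI, herror⟩ := hω.exists_hasRLDifferintegral_correctedQuad_sub_isBigO hβ hKr
    ((contDiff_ofReal_exp_mul σ).contDiffOn.mul hg)
  rw [hf]
  refine ⟨hI.substOpExists_exp_mul σ, fun X _ => ?_⟩
  obtain ⟨C, hC⟩ := Asymptotics.isBigO_principal.1 ((exp_neg_mul_isBigO_one σ X).mul (herror X))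
  refine ⟨C, fun h hh n hn hX => ?_⟩
  have hbound := hC (h, n) ⟨hh, hn, hX⟩
  rw [one_mul, Real.norm_of_nonneg (pow_nonneg hh.le p), mul_sub] at hbound
  rwa [correctedQuad_exp_mul, hI.substOp_exp_mul σ (mul_pos (by exact_mod_cast hn) hh)]

theorem theorem4p13 (α : ℝ) (β : ℂ) (p : ℕ)
    (hβ : 0 ≤ α → ∀ k : ℕ, β ≠ -(k : ℂ)) (hαβ : α < 0 → (⌈-α⌉ : ℝ) < β.re) :
    ∃ N r : ℕ, ∀ (σ : ℝ) (ω : ℕ → ℂ), IsConvergentOfOrder σ α ω p →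
      ∃ w : ℝ → ℕ → ℕ → ℂ,
        (∀ h : ℝ, 0 < h → ∀ n : ℕ, 1 ≤ n → StartingSystem σ α β ω r (w h) h n) ∧
        ∀ g : ℝ → ℂ, ContDiffOn ℝ N g (Set.Ici 0) →
          SubstOpExists σ α (fun x => (x : ℂ) ^ (β - 1) * g x) ∧
          ∀ X : ℝ, 0 < X → ∃ C : ℝ, ∀ h : ℝ, 0 < h → ∀ n : ℕ, 1 ≤ n → n * h ≤ X →
            ‖correctedQuad σ α ω r (w h) h n (fun x => (x : ℂ) ^ (β - 1) * g x) -
              substOp σ α (fun x => (x : ℂ) ^ (β - 1) * g x) (n * h)‖ ≤ C * h ^ p :=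
  theorem4p13_general α β p <| (le_or_gt 0 α).elim hβ fun hα =>
    not_exists.1 <| (Complex.Gamma_eq_zero_iff β).not.1 <| Complex.Gamma_ne_zero_of_re_pos <|
      (neg_pos.2 hα).trans ((Int.le_ceil (-α)).trans_lt (hαβ hα))
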